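/- **Setting.** Let $N=G\cup L$ be a finite set of buses, $G$ being the buses with inertia and $L$ those without. Let $E\subseteq N\times N$ be the set of transmission lines, arbitrarily directed (if $(i,j)\in E$ then $(j,i)\notin E$), such that the underlying undirected graph on $N$ is connected, and let $(G,\tilde E)$ be a connected undirected communication graph. Let $B_{ij}>0$ be the line susceptances, $M_j>0$ the inertias, $p^L_j\in\mathbb R$ constant demands, and $\Lambda_j\in\mathbb R$ the damping coefficients, with $\Lambda_j>0$ for $j\in L$. For $j\in G$ let $n_j\ge 0$, let $A_j\in\mathbb R^{n_j\times n_j}$ be Hurwitz (all eigenvalues have negative real part), $B_j\in\mathbb R^{n_j}$, $C_j\in\mathbb R^{1\times n_j}$, $D_j\in\mathbb R$, and put $K_j=-C_jA_j^{-1}B_j+D_j$. Let the gains $\gamma_j,k_{f,j},k_{c,j},k_{d,j}$ ($j\in G$) and $\alpha_{ij}=\alpha_{ji}$ (for communication links) be positive, and let $q_j>0$ be cost coefficients. Consider the system $$\dot\eta_{ij}=\omega_i-\omega_j,\quad p_{ij}=B_{ij}\sin\eta_{ij},\quad (i,j)\in E,$$ $$M_j\dot\omega_j=-p^L_j+p^M_j-\Lambda_j\omega_j-\sum_{k:(j,k)\in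 E}p_{jk}+\sum_{i:(i,j)\in E}p_{ij},\quad j\in G,$$ $$0=-p^L_j-\Lambda_j\omega_j-\sum_{k:(j,k)\in E}p_{jk}+\sum_{i:(i,j)\in E}p_{ij},\quad j\in L,$$ $$\dot x^M_j=A_jx^M_j+B_ju_j,\quad p^M_j=C_jx^M_j+D_ju_j,\quad u_j=k_{c,j}p^c_j-k_{d,j}\omega_j,\quad j\in G,$$ $$\gamma_j\dot p^c_j=p^M_j-K_ju_j-k_{f,j}\omega_j+\sum_{i:(i,j)\in\tilde E}\alpha_{ij}(p^c_i-p^c_j),\quad j\in G.$$ An equilibrium is a point $(\eta^*,\omega^*,x^{M,*},p^{c,*})$ at which all these time derivatives vanish and the algebraic equations hold. The optimal generation regulation (OGR) problem is to minimize $\sum_{j\in G}\frac12q_j(p^M_j)^2$ over $p^M\in\mathbb R^{G}$ subject to $\sum_{j\in G}p^M_j=\sum_{j\in N}p^L_j$; an equilibrium solves it if its value of $p^M$ is a global minimizer. **Theorem.** Let $\beta^*=(\eta^*,\omega^*,x^{M,*},p^{c,*})$ be an equilibrium with $|\eta^*_{ij}|<\pi/2$ for all $(i,j)\in E$. Suppose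 that $k_{c,j}=1/(q_jK_j)$ for all $j\in G$ and that for each $j\in G$ there are a symmetric positive definite $P_j\in\mathbb R^{n_j\times n_j}$ and a number $\hat\Lambda_j<\Lambda_j$ such that $$\begin{bmatrix}-K_jk_{c,j}+D_jk_{c,j}&r_j^T\\ r_j&\hat Q_j\end{bmatrix}\le0,\qquad \hat Q_j=\begin{bmatrix}\frac{P_jA_j+A_j^TP_j}{2}&\frac{k_{d,j}P_jB_j-C_j^T}{2}\\ \frac{k_{d,j}B_j^TP_j-C_j}{2}&-\hat\Lambda_j-D_jk_{d,j}\end{bmatrix},$$ $$r_j=\begin{bmatrix}\frac{k_{c,j}B_j^TP_j+C_j}{2}&\frac{k_{f,j}-k_{d,j}K_j+D_jk_{d,j}-D_jk_{c,j}}{2}\end{bmatrix}^T$$ (negative semidefiniteness). Then there is an open neighbourhood $U$ of $(\eta^*,\omega^*_G,x^{M,*},p^{c,*})$ in the space of the dynamic states $(\eta,\omega_G,x^M,p^c)$, where $\omega_G=(\omega_j)_{j\in G}$, such that from each initial condition in $U$ there is a solution on $[0,\infty)$, and every solution on $[0,\infty)$ with initial condition in $U$ converges, as $t\to\infty$, to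 the set of equilibria that have $\omega^*=0$ and solve the OGR problem (that is, its distance to this set tends to $0$). -/

import Mathlib

open scoped Matrix Topology

/-- A real square matrix is Hurwitz when all its (complex) eigenvalues lie in the open left
half plane. -/
def IsHurwitz {n : ℕ} (A : Matrix (Fin n) (Fin n) ℝ) : Prop :=
  ∀ z ∈ spectrum ℂ (A.map (fun a : ℝ => (a : ℂ))), z.re < 0

/-- The parameters of the power network, its generation dynamics and its controller.
`G` and `L` index the buses with and without inertia, so that `G ⊕ L` is the set of all buses. -/
structure PowerSystem (G L : Type*) [Fintype G] [Fintype L] where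
  /-- transmission lines, with an arbitrary direction -/
  E : Finset ((G ⊕ L) × (G ⊕ L))
  E_asymm : ∀ i j, (i, j) ∈ E → (j, i) ∉ E
  E_connected : (SimpleGraph.fromRel (fun i j => (i, j) ∈ E)).Connected
  /-- line susceptances -/
  b : E → ℝ
  b_pos : ∀ e, 0 < b e
  /-- generator inertia -/
  M : G → ℝ
  M_pos : ∀ j, 0 < M j
  /-- frequency damping; at generation buses its size is constrained by the design condition only -/
  Λ : G ⊕ L → ℝ
  Λ_load_pos : ∀ j : L, 0 < Λ (Sum.inr j)
  /-- uncontrollable demand (after the step change) -/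
  pL : G ⊕ L → ℝ
  /-- order of the generation dynamics at each generation bus -/
  n : G → ℕ
  A : (j : G) → Matrix (Fin (n j)) (Fin (n j)) ℝ
  B : (j : G) → Fin (n j) → ℝ
  C : (j : G) → Fin (n j) → ℝ
  D : G → ℝ
  A_hurwitz : ∀ j, IsHurwitz (A j)
  /-- communication graph between the generation buses -/
  comm : SimpleGraph G
  comm_connected : comm.Connected
  α : G → G → ℝ
  α_symm : ∀ i j, α i j = α j i
  α_pos : ∀ i j, comm.Adj i j → 0 < α i j
  /-- controller gains -/
  γ : G → ℝ
  γ_pos : ∀ j, 0 < γ j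
  kf : G → ℝ
  kf_pos : ∀ j, 0 < kf j
  kc : G → ℝ
  kc_pos : ∀ j, 0 < kc j
  kd : G → ℝ
  kd_pos : ∀ j, 0 < kd j

namespace PowerSystem

variable {G L : Type*} [Fintype G] [Fintype L] (S : PowerSystem G L)

/-- The steady state gain `K_j = - C_j A_j⁻¹ B_j + D_j` of the generation dynamics. -/
noncomputable def K (j : G) : ℝ := -(S.C j ⬝ᵥ ((S.A j)⁻¹ *ᵥ S.B j)) + S.D j

/-- Values of all the variables: `(η, ω, x^M, p^c)`. -/
abbrev Point : Type _ :=
  (S.E → ℝ) × (G ⊕ L → ℝ) × ((j : G) → Fin (S.n j) → ℝ) × (G → ℝ)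

/-- Values of the dynamic states `(η, ω^G, x^M, p^c)`; the frequencies at the buses without
inertia are determined by the algebraic power balance. -/
abbrev State : Type _ :=
  (S.E → ℝ) × (G → ℝ) × ((j : G) → Fin (S.n j) → ℝ) × (G → ℝ)

namespace Point

variable {S}

/-- power angle differences across the lines -/
def eta (β : S.Point) : S.E → ℝ := β.1

/-- frequency deviations at all buses -/
def omega (β : S.Point) : G ⊕ L → ℝ := β.2.1

/-- states of the generation dynamics -/
def xM (β : S.Point) : (j : G) → Fin (S.n j) → ℝ := β.2.2.1

/-- power command signals -/
def pc (β : S.Point) : G → ℝ := β.2.2.2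

/-- The part of a point that consists of the dynamic states. -/
def state (β : S.Point) : S.State := (β.eta, fun j => β.omega (Sum.inl j), β.xM, β.pc)

/-- power transfer along a line -/
noncomputable def flow (β : S.Point) (e : S.E) : ℝ := S.b e * Real.sin (β.eta e)

/-- generation input `u_j = k_{c,j} p^c_j - k_{d,j} ω_j` -/
def u (β : S.Point) (j : G) : ℝ := S.kc j * β.pc j - S.kd j * β.omega (Sum.inl j)

/-- mechanical power injection `p^M_j = C_j x^M_j + D_j u_j` -/
def pM (β : S.Point) (j : G) : ℝ := S.C j ⬝ᵥ β.xM j + S.D j * β.u j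

open scoped Classical in
/-- Minus the power leaving bus `j` plus the power entering it. -/
noncomputable def netFlow (β : S.Point) (j : G ⊕ L) : ℝ :=
  -(∑ e : S.E, if e.1.1 = j then β.flow e else 0) + ∑ e : S.E, if e.1.2 = j then β.flow e else 0

/-- `dη_{ij}/dt` -/
def etaRate (β : S.Point) (e : S.E) : ℝ := β.omega e.1.1 - β.omega e.1.2

/-- Power imbalance at a generation bus, that is, `M_j dω_j/dt`. -/
noncomputable def genBalance (β : S.Point) (j : G) : ℝ :=
  -S.pL (Sum.inl j) + β.pM j - S.Λ (Sum.inl j) * β.omega (Sum.inl j) + β.netFlow (Sum.inl j)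

/-- Power imbalance at a bus without inertia, which has to vanish. -/
noncomputable def loadBalance (β : S.Point) (j : L) : ℝ :=
  -S.pL (Sum.inr j) - S.Λ (Sum.inr j) * β.omega (Sum.inr j) + β.netFlow (Sum.inr j)

/-- `dx^M_j/dt` -/
def xMRate (β : S.Point) (j : G) : Fin (S.n j) → ℝ := S.A j *ᵥ β.xM j + β.u j • S.B j

open scoped Classical in
/-- `γ_j dp^c_j/dt` -/
noncomputable def pcDrive (β : S.Point) (j : G) : ℝ :=
  β.pM j - S.K j * β.u j - S.kf j * β.omega (Sum.inl j)
    + ∑ i : G, if S.comm.Adj i j then S.α i j * (β.pc i - β.pc j) else 0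

end Point

/-- A solution of the closed loop system on the time interval `[0, ∞)`. -/
structure IsSolution (φ : ℝ → S.Point) : Prop where
  eta : ∀ t, 0 ≤ t → ∀ e,
    HasDerivWithinAt (fun s => (φ s).eta e) ((φ t).etaRate e) (Set.Ici 0) t
  omega : ∀ t, 0 ≤ t → ∀ j : G,
    HasDerivWithinAt (fun s => (φ s).omega (Sum.inl j)) ((φ t).genBalance j / S.M j) (Set.Ici 0) t
  load : ∀ t, 0 ≤ t → ∀ j : L, (φ t).loadBalance j = 0
  xM : ∀ t, 0 ≤ t → ∀ j : G,
    HasDerivWithinAt (fun s => (φ s).xM j) ((φ t).xMRate j) (Set.Ici 0) t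
  pc : ∀ t, 0 ≤ t → ∀ j : G,
    HasDerivWithinAt (fun s => (φ s).pc j) ((φ t).pcDrive j / S.γ j) (Set.Ici 0) t

/-- An equilibrium: all time derivatives vanish (and the algebraic equations hold). -/
structure IsEquilibrium (β : S.Point) : Prop where
  eta : ∀ e, β.etaRate e = 0
  omega : ∀ j, β.genBalance j = 0
  load : ∀ j, β.loadBalance j = 0
  xM : ∀ j, β.xMRate j = 0
  pc : ∀ j, β.pcDrive j = 0

/-- The cost `∑_j q_j p_j² / 2` of the optimal generation regulation problem. -/
noncomputable def ogrCost (q p : G → ℝ) : ℝ := ∑ j, 1 / 2 * q j * p j ^ 2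

/-- `p` is a global minimizer of the optimal generation regulation problem. -/
def IsOGRSolution (q p : G → ℝ) : Prop :=
  ∑ j, p j = ∑ j, S.pL j ∧
    ∀ p' : G → ℝ, ∑ j, p' j = ∑ j, S.pL j → ogrCost q p ≤ ogrCost q p'

/-- The matrix of the primary control LMI at bus `j`. -/
noncomputable def Qhat (j : G) (P : Matrix (Fin (S.n j)) (Fin (S.n j)) ℝ) (Λh : ℝ) :
    Matrix (Fin (S.n j) ⊕ Unit) (Fin (S.n j) ⊕ Unit) ℝ :=
  Matrix.fromBlocks
    ((1 / 2 : ℝ) • (P * S.A j + (S.A j)ᵀ * P))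
    (Matrix.replicateCol Unit ((1 / 2 : ℝ) • (S.kd j • (P *ᵥ S.B j) - S.C j)))
    (Matrix.replicateRow Unit ((1 / 2 : ℝ) • (S.kd j • (S.B j ᵥ* P) - S.C j)))
    (Matrix.of fun _ _ => -Λh - S.D j * S.kd j)

/-- The vector bordering `Qhat` in the design LMI. -/
noncomputable def rVec (j : G) (P : Matrix (Fin (S.n j)) (Fin (S.n j)) ℝ) :
    Fin (S.n j) ⊕ Unit → ℝ :=
  Sum.elim ((1 / 2 : ℝ) • (S.kc j • (S.B j ᵥ* P) + S.C j))
    (fun _ => (S.kf j - S.kd j * S.K j + S.D j * S.kd j - S.D j * S.kc j) / 2)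

/-- The matrix of the design LMI at bus `j`. -/
noncomputable def designMatrix (j : G) (P : Matrix (Fin (S.n j)) (Fin (S.n j)) ℝ) (Λh : ℝ) :
    Matrix (Unit ⊕ (Fin (S.n j) ⊕ Unit)) (Unit ⊕ (Fin (S.n j) ⊕ Unit)) ℝ :=
  Matrix.fromBlocks
    (Matrix.of fun _ _ => -S.K j * S.kc j + S.D j * S.kc j)
    (Matrix.replicateRow Unit (S.rVec j P))
    (Matrix.replicateCol Unit (S.rVec j P))
    (S.Qhat j P Λh)

/-- The design condition: at each generation bus the design matrix is negative semidefinite for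
some symmetric positive definite `P_j` and some number below `Λ_j`. -/
def DesignCondition : Prop :=
  ∀ j : G, ∃ (P : Matrix (Fin (S.n j)) (Fin (S.n j)) ℝ) (Λh : ℝ),
    P.PosDef ∧ Λh < S.Λ (Sum.inl j) ∧ (-(S.designMatrix j P Λh)).PosSemidef

/-- Convergence of a trajectory to a set: the distance to the set tends to zero (this distance is
infinite when the set is empty). -/
def ConvergesTo (φ : ℝ → S.Point) (T : Set S.Point) : Prop :=
  Filter.Tendsto (fun t => Metric.infEDist (φ t) T) Filter.atTop (𝓝 0)

end PowerSystem

/-! The deviation from the given equilibrium is measured by an energy: line potentials, kinetic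
energy, squared power command deviations, and the quadratic forms of the `P j`. Tested on a suitable
vector, the design matrix inequality says that generation together with its controller dissipates at
each bus up to `Λh j * ω²`, which the true damping `Λ j > Λh j` exceeds. The network terms cancel by
summation by parts, so the energy falls at least at a rate quadratic in all frequencies and in the
power command differences across communication links (`energyRate_le`). The potentials are positive
for angles below π/2, so small sublevel sets trap solutions in a compact ball
(`exists_trapping_neighborhood`). The vector field is globally Lipschitz, so solutions exist for all
time.

In place of an invariance principle, Barbalat's lemma is used twice. Applied to the energy, it gives
ω → 0 and consensus of the power commands; applied to the frequencies of the inertial buses, it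
makes their power imbalances vanish. Summing the power balances and controller equations then leaves
a stable scalar equation for the γ-weighted mean command, so every command tends to its equilibrium
value (`tendsto_pc`). The inputs therefore converge, and by the Hurwitz property so do the
generation states. The angles need not converge, but every limit point satisfies the static power
balance and is an equilibrium; compactness turns this into convergence to the set of equilibria.

Every equilibrium has zero frequency and equal commands, and `K j * kc j = 1 / q j` makes the common
command the Lagrange multiplier of the convex cost. So all equilibria are optimal. -/

/-! ### Global existence, Barbalat's lemma, and stable linear equations with vanishing forcing -/

open Set Filter in
theorem LipschitzWith.exists_forall_hasDerivAt {V : Type*} [NormedAddCommGroup V]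
    [NormedSpace ℝ V] [CompleteSpace V] {f : V → V} {K : NNReal} (hK : LipschitzWith K f)
    (hf : ContDiff ℝ 1 f) (x : V) :
    ∃ γ : ℝ → V, γ 0 = x ∧ ∀ t, HasDerivAt γ (f (γ t)) t := by
  have hε : (0 : ℝ) < 1 / (1 + K) := by positivity
  obtain ⟨γ, h0, hγ⟩ := exists_isMIntegralCurve_of_isMIntegralCurveOn
    (I := modelWithCornersSelf ℝ V) (M := V) (v := f)
    (contMDiff_vectorSpace_iff_contDiff.2 hf) hε (fun y => by
      -- On the ball of radius ‖f y‖ about y the field is bounded by (1 + K)‖f y‖, so the existence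
      -- time 1/(1 + K) does not depend on y; local solutions therefore extend to all times.
      have hP : IsPicardLindelof (fun _ => f) (tmin := -(1 / (1 + K : ℝ)))
          (tmax := 1 / (1 + K : ℝ)) ⟨0, by constructor <;> linarith⟩ y ‖f y‖₊ 0
          (‖f y‖₊ + K * ‖f y‖₊) K := by
        refine IsPicardLindelof.of_time_independent ?_ (hK.lipschitzOnWith) ?_
        · intro z hz
          have h1 := hK.dist_le_mul z y
          rw [dist_eq_norm] at h1
          have h2 : dist z y ≤ ‖f y‖ := by simpa using hz
          have h3 : ‖f z‖ ≤ ‖f y‖ + ‖f z - f y‖ := by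
            simpa using norm_add_le (f y) (f z - f y)
          have h4 : (K : ℝ) * dist z y ≤ K * ‖f y‖ := by gcongr
          push_cast
          linarith
        · simp only [sub_zero, zero_sub, neg_neg, max_self]
          push_cast
          simp only [sub_zero]
          have : (1 + (K : ℝ)) ≠ 0 := by positivity
          field_simp
          exact le_refl _
      obtain ⟨α, hα0, hα⟩ := hP.exists_eq_forall_mem_Icc_hasDerivWithinAt₀
      refine ⟨α, hα0, fun t ht => ?_⟩
      exact (((hα t (Ioo_subset_Icc_self ht)).hasDerivAt
        (Icc_mem_nhds ht.1 ht.2)).hasDerivWithinAt).hasFDerivWithinAt.hasMFDerivWithinAt) x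
  exact ⟨γ, h0, fun t => by
    have h : HasFDerivAt γ ((1 : ℝ →L[ℝ] ℝ).smulRight (f (γ t))) t := (hγ t).hasFDerivAt
    simpa using h.hasDerivAt⟩

open Set Filter in
/-- Barbalat's lemma for the derivative of a convergent function. -/
theorem tendsto_deriv_zero_of_uniformContinuousOn {f f' : ℝ → ℝ} {l : ℝ}
    (hf : ∀ t, 0 ≤ t → HasDerivWithinAt f (f' t) (Ici 0) t)
    (hl : Tendsto f atTop (𝓝 l)) (hu : UniformContinuousOn f' (Ici 0)) :
    Tendsto f' atTop (𝓝 0) := by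
  rw [Metric.tendsto_atTop]
  intro ε hε
  obtain ⟨δ, hδ, h⟩ := Metric.uniformContinuousOn_iff.1 hu (ε / 2) (by positivity)
  set η := δ / 2 with hη
  have hη0 : 0 < η := by positivity
  have hlim : Tendsto (fun t => f (t + η) - f t) atTop (𝓝 0) := by
    simpa using (hl.comp (tendsto_atTop_add_const_right atTop η tendsto_id)).sub hl
  obtain ⟨N, hN⟩ := Metric.tendsto_atTop.1 hlim (ε / 2 * η) (by positivity)
  refine ⟨max N 0, fun t ht => ?_⟩
  have ht0 : 0 ≤ t := le_trans (le_max_right _ _) ht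
  have h1 := hN t (le_trans (le_max_left _ _) ht)
  -- On `[t, t + η]` the derivative stays within ε/2 of `f' t`, so the increment of f, which is
  -- small, is nearly `f' t * η`.
  have h2 : ‖(f (t + η) - f' t * (t + η)) - (f t - f' t * t)‖ ≤ ε / 2 * ‖t + η - t‖ := by
    refine Convex.norm_image_sub_le_of_norm_hasDerivWithin_le
      (f := fun s => f s - f' t * s) (f' := fun s => f' s - f' t) (s := Icc t (t + η))
      (fun s hs => ?_) (fun s hs => ?_) (convex_Icc _ _) ⟨le_rfl, by linarith⟩
      ⟨by linarith, le_rfl⟩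
    · have := (hf s (ht0.trans hs.1)).mono (t := Ici 0) (s := Icc t (t + η))
        (fun r hr => ht0.trans hr.1)
      exact (this.sub ((hasDerivWithinAt_id s _).const_mul (f' t))).congr_deriv (by simp)
    · have := h s (ht0.trans hs.1) t ht0 (by
        rw [Real.dist_eq, abs_lt]; constructor <;> linarith [hs.1, hs.2])
      rw [Real.dist_eq] at this
      exact this.le
  rw [Real.dist_eq, sub_zero] at h1 ⊢
  rw [Real.norm_eq_abs, Real.norm_eq_abs, add_sub_cancel_left, abs_of_pos hη0] at h2
  have h3 : |f' t * η| < ε * η := by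
    have : f' t * η = (f (t + η) - f t)
        - ((f (t + η) - f' t * (t + η)) - (f t - f' t * t)) := by ring
    rw [this]
    calc _ ≤ _ := abs_sub _ _
      _ < ε / 2 * η + ε / 2 * η := by linarith
      _ = ε * η := by ring
  rw [abs_mul, abs_of_pos hη0] at h3
  exact lt_of_mul_lt_mul_right h3 hη0.le

open Set Filter in
theorem antitoneOn_Ici_of_hasDerivWithinAt_nonpos {f f' : ℝ → ℝ} {a : ℝ}
    (hf : ∀ t, a ≤ t → HasDerivWithinAt f (f' t) (Ici a) t) (h : ∀ t, a ≤ t → f' t ≤ 0) :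
    AntitoneOn f (Ici a) := by
  refine antitoneOn_of_deriv_nonpos (convex_Ici a)
    (fun t ht => (hf t ht).continuousWithinAt) (fun t ht => ?_) (fun t ht => ?_)
  · exact ((hf t (interior_subset ht)).mono interior_subset).differentiableWithinAt
  · rw [interior_Ici] at ht
    rw [((hf t (le_of_lt ht)).hasDerivAt (Ici_mem_nhds ht)).deriv]
    exact h t (le_of_lt ht)

-- Grönwall argument: once |h| < aε/2, the function (v - ε/2)e^{at} is nonincreasing, so v
-- eventually stays below ε.
open Set Filter in
theorem tendsto_zero_of_deriv_le_neg_mul_add {v v' h : ℝ → ℝ} {a : ℝ} (ha : 0 < a)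
    (hv : ∀ t, 0 ≤ t → HasDerivWithinAt v (v' t) (Ici 0) t) (hv0 : ∀ t, 0 ≤ v t)
    (hle : ∀ t, 0 ≤ t → v' t ≤ -a * v t + h t) (hh : Tendsto h atTop (𝓝 0)) :
    Tendsto v atTop (𝓝 0) := by
  rw [Metric.tendsto_atTop]
  intro ε hε
  obtain ⟨N, hN⟩ := Metric.tendsto_atTop.1 hh (a * (ε / 2)) (by positivity)
  set T := max N 0 with hT
  have hT0 : 0 ≤ T := le_max_right _ _
  have hanti : AntitoneOn (fun t => (v t - ε / 2) * Real.exp (a * t)) (Ici T) := by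
    refine antitoneOn_Ici_of_hasDerivWithinAt_nonpos
      (f' := fun t => v' t * Real.exp (a * t)
        + (v t - ε / 2) * (Real.exp (a * t) * (a * 1))) (fun t ht => ?_) (fun t ht => ?_)
    · have h1 := ((hv t (hT0.trans ht)).mono (Ici_subset_Ici.2 hT0)).sub_const (ε / 2)
      exact h1.mul (((hasDerivWithinAt_id t _).const_mul a).exp)
    · have h1 := hN t (le_trans (le_max_left _ _) ht)
      rw [Real.dist_eq, sub_zero] at h1
      have h2 := hle t (hT0.trans ht)
      have h3 := le_abs_self (h t)
      have h4 : v' t * Real.exp (a * t) + (v t - ε / 2) * (Real.exp (a * t) * (a * 1))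
          = (v' t + a * v t - a * (ε / 2)) * Real.exp (a * t) := by ring
      rw [h4]
      exact mul_nonpos_of_nonpos_of_nonneg (by linarith) (Real.exp_pos _).le
  have hexp : Tendsto (fun t => (v T - ε / 2) * Real.exp (a * T) * Real.exp (-(a * t)))
      atTop (𝓝 0) := by
    have : Tendsto (fun t => Real.exp (-(a * t))) atTop (𝓝 0) :=
      Real.tendsto_exp_neg_atTop_nhds_zero.comp (tendsto_id.const_mul_atTop ha)
    simpa using this.const_mul ((v T - ε / 2) * Real.exp (a * T))
  obtain ⟨N', hN'⟩ := Metric.tendsto_atTop.1 hexp (ε / 2) (by positivity)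
  refine ⟨max T N', fun t ht => ?_⟩
  have h1 := hN' t (le_trans (le_max_right _ _) ht)
  have h2 := hanti (mem_Ici.2 le_rfl) (mem_Ici.2 (le_trans (le_max_left _ _) ht))
    (le_trans (le_max_left _ _) ht)
  rw [Real.dist_eq, sub_zero] at h1 ⊢
  rw [abs_of_nonneg (hv0 t)]
  have h3 : (v t - ε / 2) ≤ (v T - ε / 2) * Real.exp (a * T) * Real.exp (-(a * t)) := by
    have h4 := mul_le_mul_of_nonneg_right h2 (Real.exp_pos (-(a * t))).le
    simp only at h4
    rwa [mul_assoc (v t - ε / 2), ← Real.exp_add, add_neg_cancel, Real.exp_zero, mul_one] at h4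
  linarith [le_abs_self ((v T - ε / 2) * Real.exp (a * T) * Real.exp (-(a * t)))]

open Set Filter in
/-- A stable scalar linear equation with vanishing forcing. -/
theorem tendsto_zero_of_hasDerivWithinAt_mul_add {y g : ℝ → ℂ} {z : ℂ} (hz : z.re < 0)
    (hy : ∀ t, 0 ≤ t → HasDerivWithinAt y (z * y t + g t) (Ici 0) t)
    (hg : Tendsto g atTop (𝓝 0)) : Tendsto y atTop (𝓝 0) := by
  have hsq : Tendsto (fun t => ‖y t‖ ^ 2) atTop (𝓝 0) := by
    refine tendsto_zero_of_deriv_le_neg_mul_add (a := -z.re)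
      (v' := fun t => 2 * ((y t).re * (z * y t + g t).re + (y t).im * (z * y t + g t).im))
      (h := fun t => ‖g t‖ ^ 2 / (-z.re)) (by linarith) (fun t ht => ?_)
      (fun t => by positivity) (fun t ht => ?_) ?_
    · have hre := Complex.reCLM.hasFDerivAt.comp_hasDerivWithinAt t (hy t ht)
      have him := Complex.imCLM.hasFDerivAt.comp_hasDerivWithinAt t (hy t ht)
      have := (hre.pow 2).add (him.pow 2)
      have hfun : (fun t => ‖y t‖ ^ 2)
          = (⇑Complex.reCLM ∘ y) ^ 2 + (⇑Complex.imCLM ∘ y) ^ 2 := by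
        ext s
        simp [Complex.sq_norm, Complex.normSq_apply, ← sq]
      rw [hfun]
      refine this.congr_deriv ?_
      simp only [Function.comp_apply, Complex.reCLM_apply, Complex.imCLM_apply]
      push_cast
      ring
    · have ha : 0 < -z.re := by linarith
      simp only [Complex.sq_norm, Complex.normSq_apply, Complex.add_re, Complex.add_im,
        Complex.mul_re, Complex.mul_im]
      -- Young's inequality, weighted to spend half of the decay rate 2|Re z| of ‖y‖² on the
      -- forcing.
      have key : ∀ p q : ℝ, 2 * (p * q) ≤ -z.re * (p * p) + q * q / (-z.re) := by
        intro p q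
        have : 0 ≤ (-z.re * p - q) ^ 2 / (-z.re) := by positivity
        have e : (-z.re * p - q) ^ 2 / (-z.re)
            = -z.re * (p * p) + q * q / (-z.re) - 2 * (p * q) := by
          generalize -z.re = a at ha
          field_simp
          ring
        linarith
      have h1 := key (y t).re (g t).re
      have h2 := key (y t).im (g t).im
      rw [add_div]
      linarith
    · simpa using ((hg.norm.pow 2).div_const (-z.re))
  have := hsq.sqrt
  simp only [Real.sqrt_sq (norm_nonneg _), Real.sqrt_zero] at this
  exact tendsto_zero_iff_norm_tendsto_zero.2 this

-- If B = A - z, then By solves the same kind of system with forcing Bg, and one factor fewer must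
-- annihilate it asymptotically. Once By → 0, each component of y solves y' = zy + (By + g), a
-- scalar equation with vanishing forcing. No diagonalization or Jordan form is needed.
open Set Filter in
theorem tendsto_zero_of_list_prod_mulVec {n : ℕ} (A : Matrix (Fin n) (Fin n) ℂ) (l : List ℂ)
    (hl : ∀ z ∈ l, z.re < 0) {y g : ℝ → Fin n → ℂ}
    (hy : ∀ t, 0 ≤ t → HasDerivWithinAt y (A *ᵥ y t + g t) (Ici 0) t)
    (hg : Tendsto g atTop (𝓝 0))
    (hprod : Tendsto (fun t => (l.map (fun z => A - Matrix.scalar (Fin n) z)).prod *ᵥ y t)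
      atTop (𝓝 0)) : Tendsto y atTop (𝓝 0) := by
  -- The last factor is split off because it is the one acting directly on y.
  induction l using List.reverseRecOn generalizing y g with
  | nil => simpa using hprod
  | append_singleton l z ih =>
    set B := A - Matrix.scalar (Fin n) z with hB
    have hAB : A * B = B * A := by
      rw [hB, mul_sub, sub_mul, Matrix.scalar_comm z (fun r => mul_comm _ _) A]
    have hBy : Tendsto (fun t => B *ᵥ y t) atTop (𝓝 0) := by
      refine ih (fun w hw => hl w (by simp [hw])) (y := fun t => B *ᵥ y t)
        (g := fun t => B *ᵥ g t) (fun t ht => ?_) ?_ ?_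
      · have := (((Matrix.mulVecLin B).restrictScalars ℝ).toContinuousLinearMap.hasFDerivAt
          (x := y t)).comp_hasDerivWithinAt t (hy t ht)
        refine this.congr_deriv ?_
        simp [Matrix.mulVec_add, Matrix.mulVec_mulVec, hAB]
      · have h := ((Matrix.mulVecLin B).toContinuousLinearMap.continuous.tendsto 0).comp hg
        simpa [Function.comp_def] using h
      · simpa only [Matrix.mulVec_mulVec, List.map_append, List.map_cons, List.map_nil,
          List.prod_append, List.prod_cons, List.prod_nil, mul_one] using hprod
    rw [tendsto_pi_nhds]
    intro i
    refine tendsto_zero_of_hasDerivWithinAt_mul_add (z := z) (hl z (by simp))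
      (g := fun t => (B *ᵥ y t) i + g t i) (fun t ht => ?_) ?_
    · refine ((hasDerivWithinAt_pi.1 (hy t ht)) i).congr_deriv ?_
      simp [hB, Matrix.sub_mulVec]
      ring
    · simpa using (tendsto_pi_nhds.1 hBy i).add (tendsto_pi_nhds.1 hg i)

open Set Filter in
/-- A Hurwitz linear system with vanishing forcing. -/
theorem IsHurwitz.tendsto_zero {n : ℕ} {A : Matrix (Fin n) (Fin n) ℝ} (hA : IsHurwitz A)
    {x g : ℝ → Fin n → ℝ}
    (hx : ∀ t, 0 ≤ t → HasDerivWithinAt x (A *ᵥ x t + g t) (Ici 0) t)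
    (hg : Tendsto g atTop (𝓝 0)) : Tendsto x atTop (𝓝 0) := by
  set Ac := A.map (fun a : ℝ => (a : ℂ)) with hAc
  have key : Tendsto (fun t i => (x t i : ℂ)) atTop (𝓝 0) := by
    refine tendsto_zero_of_list_prod_mulVec Ac Ac.charpoly.roots.toList (fun z hz => ?_)
      (g := fun t i => (g t i : ℂ)) (fun t ht => ?_) ?_ ?_
    · refine hA z ?_
      rw [Matrix.mem_spectrum_iff_isRoot_charpoly]
      exact Polynomial.isRoot_of_mem_roots (Multiset.mem_toList.1 hz)
    · rw [hasDerivWithinAt_pi]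
      intro i
      have := Complex.ofRealCLM.hasFDerivAt.comp_hasDerivWithinAt t
        (hasDerivWithinAt_pi.1 (hx t ht) i)
      refine this.congr_deriv ?_
      simp [Matrix.mulVec, dotProduct, hAc]
    · rw [tendsto_pi_nhds] at hg ⊢
      intro i
      simpa using! (Complex.continuous_ofReal.tendsto _).comp (hg i)
    -- Cayley–Hamilton, with the characteristic polynomial split over ℂ.
    · have h0 : (Ac.charpoly.roots.toList.map
          (fun z => Ac - Matrix.scalar (Fin n) z)).prod = 0 := by
        have h1 := Matrix.aeval_self_charpoly Ac
        have h2 := (IsAlgClosed.splits Ac.charpoly).eq_prod_roots_of_monic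
          (Matrix.charpoly_monic Ac)
        rw [← Multiset.coe_toList Ac.charpoly.roots, Multiset.map_coe, Multiset.prod_coe] at h2
        rw [h2, map_list_prod, List.map_map] at h1
        rw [← h1]
        congr 1
        refine List.map_congr_left fun z _ => ?_
        simp [Matrix.algebraMap_eq_diagonal]
      simp only [h0, Matrix.zero_mulVec]
      exact tendsto_const_nhds
  rw [tendsto_pi_nhds] at key ⊢
  intro i
  simpa using! (Complex.continuous_re.tendsto _).comp (key i)

theorem SimpleGraph.Connected.rel_of_adj {V : Type*} {Γ : SimpleGraph V} (h : Γ.Connected)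
    {r : V → V → Prop} (hrefl : ∀ a, r a a) (htrans : ∀ a b c, r a b → r b c → r a c)
    (hadj : ∀ a b, Γ.Adj a b → r a b) (a b : V) : r a b := by
  obtain ⟨w⟩ := h.preconnected a b
  induction w with
  | nil => exact hrefl _
  | cons hd _ ih => exact htrans _ _ _ (hadj _ _ hd) ih

theorem IsHurwitz.isUnit_det {n : ℕ} {A : Matrix (Fin n) (Fin n) ℝ} (hA : IsHurwitz A) :
    IsUnit A.det := by
  have h : (0 : ℂ) ∉ spectrum ℂ (A.map (fun a : ℝ => (a : ℂ))) := fun h0 => by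
    simpa using hA 0 h0
  rw [spectrum.zero_notMem_iff, Matrix.isUnit_iff_isUnit_det, isUnit_iff_ne_zero] at h
  rw [isUnit_iff_ne_zero]
  intro h0
  have := RingHom.map_det Complex.ofRealHom A
  rw [h0, map_zero] at this
  exact h this.symm

/-! ### Power balances and properties of equilibria -/

namespace PowerSystem

variable {G L : Type*} [Fintype G] [Fintype L] (S : PowerSystem G L)

section Algebra

variable {S}

-- Summation by parts: the net flow is minus the adjoint of the difference operator giving the angle
-- rates. This lets line potentials cancel network power in the energy balance.
open scoped Classical in
theorem sum_mul_netFlow (β : S.Point) (w : G ⊕ L → ℝ) :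
    ∑ i, w i * β.netFlow i = -∑ e : S.E, β.flow e * (w e.1.1 - w e.1.2) := by
  simp only [Point.netFlow, mul_add, mul_neg, Finset.sum_add_distrib, Finset.sum_neg_distrib,
    Finset.mul_sum]
  rw [Finset.sum_comm, Finset.sum_comm (γ := G ⊕ L)]
  simp only [mul_ite, mul_zero, Finset.sum_ite_eq, Finset.mem_univ, if_true, mul_sub,
    Finset.sum_sub_distrib]
  simp only [mul_comm]
  ring

theorem sum_netFlow (β : S.Point) : ∑ i, β.netFlow i = 0 := by
  simpa using sum_mul_netFlow β 1

theorem sum_balance (β : S.Point) :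
    ∑ j, β.genBalance j + ∑ j, β.loadBalance j
      = ∑ j, β.pM j - ∑ i, S.pL i - ∑ i, S.Λ i * β.omega i := by
  have h := sum_netFlow β
  rw [Fintype.sum_sum_type] at h ⊢
  rw [Fintype.sum_sum_type]
  simp only [Point.genBalance, Point.loadBalance, Finset.sum_add_distrib, Finset.sum_sub_distrib,
    Finset.sum_neg_distrib]
  linarith

-- The weighted Laplacian is symmetric, so its bilinear form is minus half the sum over ordered
-- pairs. With w = 1 the total exchange vanishes; with w = p it is a dissipation.
open scoped Classical in
theorem sum_mul_comm (p w : G → ℝ) :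
    ∑ j, w j * ∑ i, (if S.comm.Adj i j then S.α i j * (p i - p j) else 0)
      = -(1 / 2) * ∑ j, ∑ i, if S.comm.Adj i j then
          S.α i j * ((p i - p j) * (w i - w j)) else 0 := by
  have h1 : ∀ f : G → G → ℝ, (∀ i j, f i j = f j i) →
      ∑ j, ∑ i, f i j * ((p i - p j) * (w i - w j))
        = -2 * ∑ j, ∑ i, w j * (f i j * (p i - p j)) := by
    intro f hf
    have h2 : ∑ j, ∑ i, w i * (f i j * (p i - p j))
        = -∑ j, ∑ i, w j * (f i j * (p i - p j)) := by
      rw [Finset.sum_comm, ← Finset.sum_neg_distrib]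
      refine Finset.sum_congr rfl fun i _ => ?_
      rw [← Finset.sum_neg_distrib]
      refine Finset.sum_congr rfl fun j _ => ?_
      rw [hf]
      ring
    have h3 : ∀ i j, f i j * ((p i - p j) * (w i - w j))
        = w i * (f i j * (p i - p j)) - w j * (f i j * (p i - p j)) := fun i j => by ring
    simp only [h3, Finset.sum_sub_distrib, h2]
    ring
  have h4 := h1 (fun i j => if S.comm.Adj i j then S.α i j else 0) (fun i j => by
    simp only [S.comm.adj_comm i j, S.α_symm i j])
  simp only [ite_mul, zero_mul] at h4
  rw [h4]
  simp only [Finset.mul_sum, mul_ite, mul_zero, neg_mul, one_div]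
  refine Finset.sum_congr rfl fun j _ => Finset.sum_congr rfl fun i _ => ?_
  split_ifs <;> ring

open scoped Classical in
theorem sum_pcDrive (β : S.Point) :
    ∑ j, β.pcDrive j
      = ∑ j, β.pM j - ∑ j, S.K j * β.u j - ∑ j, S.kf j * β.omega (Sum.inl j) := by
  have h := sum_mul_comm (S := S) β.pc 1
  simp only [Pi.one_apply, one_mul, sub_self, mul_zero, ite_self, Finset.sum_const_zero] at h
  simp only [Point.pcDrive, Finset.sum_add_distrib, Finset.sum_sub_distrib, h, add_zero]

theorem pM_eq_of_xMRate_eq_zero {β : S.Point} {j : G} (h : β.xMRate j = 0) :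
    β.pM j = S.K j * β.u j := by
  have hx : β.xM j = -(β.u j • ((S.A j)⁻¹ *ᵥ S.B j)) := by
    have h1 : (S.A j)⁻¹ *ᵥ (S.A j *ᵥ β.xM j + β.u j • S.B j) = 0 := by
      rw [show S.A j *ᵥ β.xM j + β.u j • S.B j = 0 from h, Matrix.mulVec_zero]
    rw [Matrix.mulVec_add, Matrix.mulVec_mulVec, Matrix.nonsing_inv_mul _
      (S.A_hurwitz j).isUnit_det, Matrix.one_mulVec, Matrix.mulVec_smul] at h1
    exact eq_neg_of_add_eq_zero_left h1
  rw [Point.pM, K, hx]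
  simp only [dotProduct_neg, dotProduct_smul, smul_eq_mul]
  ring

end Algebra

namespace IsEquilibrium

variable {S} {β : S.Point}

/-- Stationary angles force one common frequency. In the sum of the controller equations,
communication cancels and so does pM - K u, leaving (∑ kf) ω = 0. -/
theorem omega_eq_zero (h : S.IsEquilibrium β) : β.omega = 0 := by
  have hconst : ∀ i k, β.omega i = β.omega k :=
    S.E_connected.rel_of_adj (fun _ => rfl) (fun _ _ _ => Eq.trans) (fun i k hik => by
      rcases hik.2 with he | he
      · exact sub_eq_zero.1 (h.eta ⟨_, he⟩)
      · exact (sub_eq_zero.1 (h.eta ⟨_, he⟩)).symm)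
  obtain ⟨j₀⟩ := S.comm_connected.nonempty
  have hs := sum_pcDrive β
  simp only [h.pc, pM_eq_of_xMRate_eq_zero (h.xM _), Finset.sum_const_zero, sub_self, zero_sub,
    hconst _ (Sum.inl j₀), ← Finset.sum_mul] at hs
  have hk : 0 < ∑ j, S.kf j := Finset.sum_pos (fun j _ => S.kf_pos j) ⟨j₀, Finset.mem_univ _⟩
  have h0 : β.omega (Sum.inl j₀) = 0 := by
    rcases mul_eq_zero.1 (neg_eq_zero.1 hs.symm) with h1 | h1
    · exact absurd h1 hk.ne'
    · exact h1
  funext i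
  rw [hconst i (Sum.inl j₀), h0, Pi.zero_apply]

theorem pc_eq (h : S.IsEquilibrium β) (i j : G) : β.pc i = β.pc j := by
  classical
  have hω := h.omega_eq_zero
  have hd : ∀ j, ∑ i, (if S.comm.Adj i j then S.α i j * (β.pc i - β.pc j) else 0) = 0 := by
    intro j
    have := h.pc j
    rw [Point.pcDrive, pM_eq_of_xMRate_eq_zero (h.xM j), hω] at this
    simpa using this
  have hs := sum_mul_comm (S := S) β.pc β.pc
  simp only [hd, mul_zero, Finset.sum_const_zero] at hs
  have hnn : ∀ i j, 0 ≤ if S.comm.Adj i j then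
      S.α i j * ((β.pc i - β.pc j) * (β.pc i - β.pc j)) else 0 := by
    intro i j
    split_ifs with hij
    · exact mul_nonneg (S.α_pos i j hij).le (mul_self_nonneg _)
    · exact le_rfl
  have hz : ∑ j, ∑ i, (if S.comm.Adj i j then
      S.α i j * ((β.pc i - β.pc j) * (β.pc i - β.pc j)) else 0) = 0 := by linarith
  refine S.comm_connected.rel_of_adj (r := fun i j => β.pc i = β.pc j) (fun _ => rfl)
    (fun _ _ _ => Eq.trans) (fun i j hij => ?_) i j
  have h1 := (Finset.sum_eq_zero_iff_of_nonneg
    (fun j _ => Finset.sum_nonneg fun i _ => hnn i j)).1 hz j (Finset.mem_univ _)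
  have h2 := (Finset.sum_eq_zero_iff_of_nonneg (fun i _ => hnn i j)).1 h1 i (Finset.mem_univ _)
  rw [if_pos hij] at h2
  rcases mul_eq_zero.1 h2 with h3 | h3
  · exact absurd h3 (S.α_pos i j hij).ne'
  · exact sub_eq_zero.1 (mul_self_eq_zero.1 h3)

/-- The marginal costs `q j * pM j` all equal the common power command, which acts as the multiplier
of the balance constraint; completing squares gives global optimality. -/
theorem isOGRSolution (h : S.IsEquilibrium β) {q : G → ℝ} (hq : ∀ j, 0 < q j)
    (hK : ∀ j, S.K j * S.kc j = 1 / q j) : S.IsOGRSolution q β.pM := by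
  have hω := h.omega_eq_zero
  have hsum : ∑ j, β.pM j = ∑ j, S.pL j := by
    have := sum_balance β
    simp only [h.omega, h.load, hω, Pi.zero_apply, mul_zero, Finset.sum_const_zero] at this
    linarith
  obtain ⟨j₀⟩ := S.comm_connected.nonempty
  have hp : ∀ j, q j * β.pM j = β.pc j₀ := by
    intro j
    rw [pM_eq_of_xMRate_eq_zero (h.xM j), Point.u, hω, h.pc_eq j₀ j, Pi.zero_apply, mul_zero,
      sub_zero, ← mul_assoc (S.K j), hK]
    have := (hq j).ne'
    field_simp
  refine ⟨hsum, fun p' hp' => ?_⟩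
  have h1 : ∑ j, (1 / 2 * q j * p' j ^ 2 - 1 / 2 * q j * β.pM j ^ 2
      - β.pc j₀ * (p' j - β.pM j)) = ∑ j, 1 / 2 * q j * (p' j - β.pM j) ^ 2 :=
    Finset.sum_congr rfl fun j _ => by rw [← hp j]; ring
  have h2 : 0 ≤ ∑ j, 1 / 2 * q j * (p' j - β.pM j) ^ 2 :=
    Finset.sum_nonneg fun j _ => by have := hq j; positivity
  simp only [Finset.sum_sub_distrib, ← Finset.mul_sum] at h1
  unfold ogrCost
  rw [hp', hsum] at h1
  simp only [sub_self, mul_zero, sub_zero] at h1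
  linarith

end IsEquilibrium

/-! ### The design condition as a dissipation inequality -/

theorem design_inequality {j : G} {P : Matrix (Fin (S.n j)) (Fin (S.n j)) ℝ} {Λh : ℝ}
    (hP : P.PosDef) (h : (-(S.designMatrix j P Λh)).PosSemidef) (p w : ℝ)
    (x : Fin (S.n j) → ℝ) :
    x ⬝ᵥ (P *ᵥ (S.A j *ᵥ x + (S.kc j * p - S.kd j * w) • S.B j))
      + w * (S.C j ⬝ᵥ x + S.D j * (S.kc j * p - S.kd j * w))
      + p * (S.C j ⬝ᵥ x + S.D j * (S.kc j * p - S.kd j * w)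
        - S.K j * (S.kc j * p - S.kd j * w) - S.kf j * w) ≤ Λh * w ^ 2 := by
  have hsymm : Pᵀ = P := by simpa using hP.isHermitian.eq
  have hPB : S.B j ᵥ* P = P *ᵥ S.B j := by
    rw [← Matrix.mulVec_transpose, hsymm]
  have hT : x ⬝ᵥ ((S.A j)ᵀ *ᵥ (P *ᵥ x)) = x ⬝ᵥ (P *ᵥ (S.A j *ᵥ x)) := by
    rw [Matrix.dotProduct_mulVec, Matrix.vecMul_transpose, Matrix.dotProduct_mulVec x P,
      ← Matrix.mulVec_transpose, hsymm, dotProduct_comm]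
  -- The frequency enters with a minus sign because the input contains `-kd * w`; this matches the
  -- signs in the off-diagonal blocks.
  have h1 := h.dotProduct_mulVec_nonneg (Sum.elim (fun _ => p) (Sum.elim x (fun _ => -w)))
  rw [Matrix.neg_mulVec, dotProduct_neg, star_trivial, neg_nonneg] at h1
  simp only [designMatrix, Qhat, rVec, hPB] at h1
  rw [Matrix.fromBlocks_mulVec, Sum.elim_comp_inl, Sum.elim_comp_inr, Matrix.fromBlocks_mulVec,
    Sum.elim_comp_inl, Sum.elim_comp_inr] at h1
  simp only [sumElim_dotProduct_sumElim, dotProduct_add, Matrix.replicateRow_mulVec_eq_const,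
    Matrix.add_mulVec, Matrix.smul_mulVec, ← Matrix.mulVec_mulVec, dotProduct_smul, hT] at h1
  have hcol : ∀ {m : Type} (v : m → ℝ) (c : ℝ),
      Matrix.replicateCol Unit v *ᵥ (fun _ => c) = c • v := fun v c => by
    ext i
    simp [Matrix.mulVec, dotProduct, mul_comm]
  have hone : ∀ f g : Unit → ℝ, f ⬝ᵥ g = f () * g () := fun f g => by simp [dotProduct]
  have hof : ∀ a c : ℝ, (Matrix.of fun _ _ : Unit => a) *ᵥ (fun _ => c) = fun _ => a * c :=
    fun a c => by
      ext i
      simp [Matrix.mulVec, dotProduct]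
  simp only [hcol, hone, hof, Function.const_apply, dotProduct_smul, smul_eq_mul,
    sumElim_dotProduct_sumElim, dotProduct_add, dotProduct_sub, dotProduct_comm _ x] at h1
  rw [Matrix.mulVec_add, Matrix.mulVec_smul, dotProduct_add, dotProduct_smul, smul_eq_mul,
    dotProduct_comm _ x]
  linarith

end PowerSystem

/-- Lipschitz continuity with an unspecified constant. -/
def IsLipschitz {X Y : Type*} [PseudoEMetricSpace X] [PseudoEMetricSpace Y] (f : X → Y) : Prop :=
  ∃ K, LipschitzWith K f

/-! ### Closure properties of Lipschitz maps -/

namespace IsLipschitz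

variable {X : Type*} [PseudoEMetricSpace X]

theorem const {Y : Type*} [PseudoEMetricSpace Y] (c : Y) : IsLipschitz (fun _ : X => c) :=
  ⟨0, LipschitzWith.const c⟩

theorem add {f g : X → ℝ} (hf : IsLipschitz f) (hg : IsLipschitz g) :
    IsLipschitz (fun x => f x + g x) :=
  ⟨_, hf.choose_spec.add hg.choose_spec⟩

theorem neg {f : X → ℝ} (hf : IsLipschitz f) : IsLipschitz (fun x => -f x) :=
  ⟨_, hf.choose_spec.neg⟩

theorem sub {f g : X → ℝ} (hf : IsLipschitz f) (hg : IsLipschitz g) :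
    IsLipschitz (fun x => f x - g x) :=
  ⟨_, hf.choose_spec.sub hg.choose_spec⟩

theorem const_mul (c : ℝ) {f : X → ℝ} (hf : IsLipschitz f) : IsLipschitz (fun x => c * f x) :=
  ⟨_, (lipschitzWith_smul c).comp hf.choose_spec⟩

theorem mul_const {f : X → ℝ} (hf : IsLipschitz f) (c : ℝ) : IsLipschitz (fun x => f x * c) := by
  simpa only [mul_comm _ c] using hf.const_mul c

theorem div_const {f : X → ℝ} (hf : IsLipschitz f) (c : ℝ) : IsLipschitz (fun x => f x / c) := by
  simpa only [div_eq_mul_inv] using hf.mul_const c⁻¹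

theorem sum {ι : Type*} (s : Finset ι) {f : ι → X → ℝ} (hf : ∀ i, IsLipschitz (f i)) :
    IsLipschitz (fun x => ∑ i ∈ s, f i x) := by
  classical
  induction s using Finset.induction_on with
  | empty => simpa using const (X := X) (0 : ℝ)
  | insert i s hi ih => simpa only [Finset.sum_insert hi] using (hf i).add ih

theorem ite_zero (p : Prop) [Decidable p] {f : X → ℝ} (hf : IsLipschitz f) :
    IsLipschitz (fun x => if p then f x else 0) := by
  split_ifs
  · exact hf
  · exact const 0

theorem sin {f : X → ℝ} (hf : IsLipschitz f) : IsLipschitz (fun x => Real.sin (f x)) :=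
  ⟨_, (lipschitzWith_of_nnnorm_deriv_le (C := 1) Real.differentiable_sin fun x => by
    rw [← NNReal.coe_le_coe]
    simpa using Real.abs_cos_le_one x).comp hf.choose_spec⟩

theorem pi {ι : Type*} [Fintype ι] {Y : ι → Type*} [∀ i, PseudoEMetricSpace (Y i)]
    {f : X → ∀ i, Y i} (hf : ∀ i, IsLipschitz (fun x => f x i)) : IsLipschitz f := by
  choose K hK using hf
  refine ⟨∑ i, K i, fun x y => ?_⟩
  rw [edist_pi_le_iff]
  intro i
  refine (hK i x y).trans ?_
  gcongr
  exact Finset.single_le_sum (f := K) (fun _ _ => zero_le) (Finset.mem_univ i)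

theorem prodMk {Y Z : Type*} [PseudoEMetricSpace Y] [PseudoEMetricSpace Z] {f : X → Y} {g : X → Z}
    (hf : IsLipschitz f) (hg : IsLipschitz g) : IsLipschitz (fun x => (f x, g x)) :=
  ⟨_, hf.choose_spec.prodMk hg.choose_spec⟩

theorem apply {ι : Type*} [Fintype ι] {Y : ι → Type*} [∀ i, PseudoEMetricSpace (Y i)]
    {f : X → ∀ i, Y i} (hf : IsLipschitz f) (i : ι) : IsLipschitz (fun x => f x i) :=
  ⟨_, (LipschitzWith.eval i).comp hf.choose_spec⟩

theorem fst {Y Z : Type*} [PseudoEMetricSpace Y] [PseudoEMetricSpace Z] {f : X → Y × Z}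
    (hf : IsLipschitz f) : IsLipschitz (fun x => (f x).1) :=
  ⟨_, LipschitzWith.prod_fst.comp hf.choose_spec⟩

theorem snd {Y Z : Type*} [PseudoEMetricSpace Y] [PseudoEMetricSpace Z] {f : X → Y × Z}
    (hf : IsLipschitz f) : IsLipschitz (fun x => (f x).2) :=
  ⟨_, LipschitzWith.prod_snd.comp hf.choose_spec⟩

theorem id : IsLipschitz (fun x : X => x) := ⟨_, LipschitzWith.id⟩

end IsLipschitz

theorem HasDerivAt.prod_fst {E F : Type*} [NormedAddCommGroup E] [NormedSpace ℝ E]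
    [NormedAddCommGroup F] [NormedSpace ℝ F] {f : ℝ → E × F} {f' : E × F} {t : ℝ}
    (h : HasDerivAt f f' t) : HasDerivAt (fun s => (f s).1) f'.1 t :=
  (ContinuousLinearMap.fst ℝ E F).hasFDerivAt.comp_hasDerivAt t h

theorem HasDerivAt.prod_snd {E F : Type*} [NormedAddCommGroup E] [NormedSpace ℝ E]
    [NormedAddCommGroup F] [NormedSpace ℝ F] {f : ℝ → E × F} {f' : E × F} {t : ℝ}
    (h : HasDerivAt f f' t) : HasDerivAt (fun s => (f s).2) f'.2 t :=
  (ContinuousLinearMap.snd ℝ E F).hasFDerivAt.comp_hasDerivAt t h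

/-! ### Reduction to an ordinary differential equation on the dynamic states -/

namespace PowerSystem

variable {G L : Type*} [Fintype G] [Fintype L] (S : PowerSystem G L)

/-- The frequencies at the buses without inertia that balance the power there. -/
noncomputable def loadOmega (η : S.E → ℝ) (j : L) : ℝ :=
  (-S.pL (Sum.inr j) + Point.netFlow (S := S) (η, 0, 0, 0) (Sum.inr j)) / S.Λ (Sum.inr j)

/-- The point determined by the dynamic states. -/
noncomputable def toPoint (σ : S.State) : S.Point :=
  (σ.1, Sum.elim σ.2.1 (S.loadOmega σ.1), σ.2.2.1, σ.2.2.2)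

/-- The vector field on the dynamic states. -/
noncomputable def field (σ : S.State) : S.State :=
  (fun e => (S.toPoint σ).etaRate e, fun j => (S.toPoint σ).genBalance j / S.M j,
    fun j => (S.toPoint σ).xMRate j, fun j => (S.toPoint σ).pcDrive j / S.γ j)

theorem toPoint_state (σ : S.State) : (S.toPoint σ).state = σ := rfl

theorem loadBalance_toPoint (σ : S.State) (j : L) : (S.toPoint σ).loadBalance j = 0 := by
  have h : (S.toPoint σ).omega (Sum.inr j) = S.loadOmega σ.1 j := rfl
  rw [Point.loadBalance, h, loadOmega, mul_div_cancel₀ _ (S.Λ_load_pos j).ne']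
  have h2 : (S.toPoint σ).netFlow (Sum.inr j)
    = Point.netFlow (S := S) (σ.1, 0, 0, 0) (Sum.inr j) := rfl
  rw [h2]
  ring

/-- Positive load damping makes the algebraic equation uniquely solvable for the load frequencies,
so solutions correspond to trajectories of `field`. -/
theorem toPoint_state_of_loadBalance {β : S.Point} (h : ∀ j, β.loadBalance j = 0) :
    S.toPoint β.state = β := by
  have h2 : Sum.elim (fun j => β.omega (Sum.inl j)) (S.loadOmega β.eta) = β.omega := by
    funext i
    rcases i with j | j
    · rfl
    · have h3 := h j
      have h4 : Point.netFlow (S := S) (β.eta, 0, 0, 0) (Sum.inr j) = β.netFlow (Sum.inr j) := rfl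
      rw [Point.loadBalance] at h3
      rw [Sum.elim_inr, loadOmega, h4, div_eq_iff (S.Λ_load_pos j).ne']
      linarith
  change (β.eta, Sum.elim (fun j => β.omega (Sum.inl j)) (S.loadOmega β.eta), β.xM, β.pc) = β
  rw [h2]
  rfl

theorem IsSolution.toPoint_state {S : PowerSystem G L} {φ : ℝ → S.Point} (h : S.IsSolution φ)
    {t : ℝ} (ht : 0 ≤ t) : S.toPoint (φ t).state = φ t :=
  S.toPoint_state_of_loadBalance (h.load t ht)

theorem IsSolution.hasDerivWithinAt_state {S : PowerSystem G L} {φ : ℝ → S.Point}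
    (h : S.IsSolution φ) {t : ℝ} (ht : 0 ≤ t) :
    HasDerivWithinAt (fun s => (φ s).state) (S.field (φ t).state) (Set.Ici 0) t := by
  rw [field, h.toPoint_state ht]
  exact (hasDerivWithinAt_pi.2 (h.eta t ht)).prodMk ((hasDerivWithinAt_pi.2 (h.omega t ht)).prodMk
    ((hasDerivWithinAt_pi.2 (h.xM t ht)).prodMk (hasDerivWithinAt_pi.2 (h.pc t ht))))

theorem isSolution_of_hasDerivAt {σ : ℝ → S.State} (h : ∀ t, HasDerivAt σ (S.field (σ t)) t) :
    S.IsSolution (fun t => S.toPoint (σ t)) where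
  eta t _ := hasDerivWithinAt_pi.1 ((h t).prod_fst).hasDerivWithinAt
  omega t _ := hasDerivWithinAt_pi.1 ((h t).prod_snd.prod_fst).hasDerivWithinAt
  load t _ := S.loadBalance_toPoint (σ t)
  xM t _ := hasDerivWithinAt_pi.1 ((h t).prod_snd.prod_snd.prod_fst).hasDerivWithinAt
  pc t _ := hasDerivWithinAt_pi.1 ((h t).prod_snd.prod_snd.prod_snd).hasDerivWithinAt

section Smooth

theorem contDiff_flow (e : S.E) : ContDiff ℝ 1 fun σ : S.State => (S.toPoint σ).flow e := by
  change ContDiff ℝ 1 fun σ : S.State => S.b e * Real.sin (σ.1 e)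
  fun_prop

theorem contDiff_netFlow (i : G ⊕ L) :
    ContDiff ℝ 1 fun σ : S.State => (S.toPoint σ).netFlow i := by
  classical
  unfold Point.netFlow
  refine ((ContDiff.sum fun e _ => ?_).neg).add (ContDiff.sum fun e _ => ?_) <;> split_ifs
  · exact S.contDiff_flow e
  · exact contDiff_const
  · exact S.contDiff_flow e
  · exact contDiff_const

theorem contDiff_omega (i : G ⊕ L) : ContDiff ℝ 1 fun σ : S.State => (S.toPoint σ).omega i := by
  rcases i with j | j
  · change ContDiff ℝ 1 fun σ : S.State => σ.2.1 j
    fun_prop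
  · exact (contDiff_const.add (S.contDiff_netFlow (Sum.inr j))).div_const _

theorem contDiff_pc (j : G) : ContDiff ℝ 1 fun σ : S.State => (S.toPoint σ).pc j := by
  change ContDiff ℝ 1 fun σ : S.State => σ.2.2.2 j
  fun_prop

theorem contDiff_xM (j : G) (k : Fin (S.n j)) :
    ContDiff ℝ 1 fun σ : S.State => (S.toPoint σ).xM j k := by
  have h : ContDiff ℝ 1 fun σ : S.State => σ.2.2.1 := by fun_prop
  exact contDiff_pi.1 (contDiff_pi.1 h j) k

theorem contDiff_u (j : G) : ContDiff ℝ 1 fun σ : S.State => (S.toPoint σ).u j :=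
  (contDiff_const.mul (S.contDiff_pc j)).sub (contDiff_const.mul (S.contDiff_omega _))

theorem contDiff_pM (j : G) : ContDiff ℝ 1 fun σ : S.State => (S.toPoint σ).pM j :=
  (ContDiff.sum fun k _ => contDiff_const.mul (S.contDiff_xM j k)).add
    (contDiff_const.mul (S.contDiff_u j))

theorem contDiff_etaRate (e : S.E) : ContDiff ℝ 1 fun σ : S.State => (S.toPoint σ).etaRate e :=
  (S.contDiff_omega _).sub (S.contDiff_omega _)

theorem contDiff_genBalance (j : G) :
    ContDiff ℝ 1 fun σ : S.State => (S.toPoint σ).genBalance j :=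
  ((contDiff_const.add (S.contDiff_pM j)).sub (contDiff_const.mul (S.contDiff_omega _))).add
    (S.contDiff_netFlow _)

theorem contDiff_xMRate (j : G) : ContDiff ℝ 1 fun σ : S.State => (S.toPoint σ).xMRate j := by
  refine contDiff_pi.2 fun i => ?_
  change ContDiff ℝ 1 fun σ : S.State =>
    ∑ k, S.A j i k * (S.toPoint σ).xM j k + (S.toPoint σ).u j * S.B j i
  exact (ContDiff.sum fun k _ => contDiff_const.mul (S.contDiff_xM j k)).add
    ((S.contDiff_u j).mul contDiff_const)

theorem contDiff_pcDrive (j : G) : ContDiff ℝ 1 fun σ : S.State => (S.toPoint σ).pcDrive j := by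
  classical
  refine (((S.contDiff_pM j).sub (contDiff_const.mul (S.contDiff_u j))).sub
    (contDiff_const.mul (S.contDiff_omega _))).add (ContDiff.sum fun i _ => ?_)
  split_ifs
  · exact contDiff_const.mul ((S.contDiff_pc i).sub (S.contDiff_pc j))
  · exact contDiff_const

theorem contDiff_field : ContDiff ℝ 1 S.field :=
  (contDiff_pi.2 S.contDiff_etaRate).prodMk
    ((contDiff_pi.2 fun j => (S.contDiff_genBalance j).div_const _).prodMk
      ((contDiff_pi.2 S.contDiff_xMRate).prodMk
        (contDiff_pi.2 fun j => (S.contDiff_pcDrive j).div_const _)))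

end Smooth

section Lipschitz

theorem isLipschitz_netFlow (i : G ⊕ L) :
    IsLipschitz fun σ : S.State => (S.toPoint σ).netFlow i := by
  classical
  have h : ∀ e, IsLipschitz fun σ : S.State => (S.toPoint σ).flow e := fun e =>
    (IsLipschitz.id.fst.apply e).sin.const_mul _
  exact ((IsLipschitz.sum _ fun e => (h e).ite_zero _).neg).add
    (IsLipschitz.sum _ fun e => (h e).ite_zero _)

theorem isLipschitz_omega (i : G ⊕ L) :
    IsLipschitz fun σ : S.State => (S.toPoint σ).omega i := by
  rcases i with j | j
  · exact IsLipschitz.id.snd.fst.apply j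
  · exact ((IsLipschitz.const _).add (S.isLipschitz_netFlow (Sum.inr j))).div_const _

theorem isLipschitz_pc (j : G) : IsLipschitz fun σ : S.State => (S.toPoint σ).pc j :=
  IsLipschitz.id.snd.snd.snd.apply j

theorem isLipschitz_xM (j : G) (k : Fin (S.n j)) :
    IsLipschitz fun σ : S.State => (S.toPoint σ).xM j k :=
  (IsLipschitz.id.snd.snd.fst.apply j).apply k

theorem isLipschitz_u (j : G) : IsLipschitz fun σ : S.State => (S.toPoint σ).u j :=
  ((S.isLipschitz_pc j).const_mul _).sub ((S.isLipschitz_omega _).const_mul _)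

theorem isLipschitz_pM (j : G) : IsLipschitz fun σ : S.State => (S.toPoint σ).pM j :=
  (IsLipschitz.sum _ fun k => (S.isLipschitz_xM j k).const_mul _).add
    ((S.isLipschitz_u j).const_mul _)

/-- The sine is the only nonlinearity and is globally Lipschitz; everything else is affine. This
excludes finite-time blow-up. -/
theorem isLipschitz_field : IsLipschitz S.field := by
  classical
  refine (IsLipschitz.pi fun e => ?_).prodMk ((IsLipschitz.pi fun j => ?_).prodMk
    ((IsLipschitz.pi fun j => IsLipschitz.pi fun k => ?_).prodMk (IsLipschitz.pi fun j => ?_)))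
  · exact (S.isLipschitz_omega _).sub (S.isLipschitz_omega _)
  · exact (((((IsLipschitz.const _).add (S.isLipschitz_pM j)).sub
      ((S.isLipschitz_omega _).const_mul _)).add (S.isLipschitz_netFlow _))).div_const _
  · change IsLipschitz fun σ : S.State =>
      ∑ i, S.A j k i * (S.toPoint σ).xM j i + (S.toPoint σ).u j * S.B j k
    exact (IsLipschitz.sum _ fun i => (S.isLipschitz_xM j i).const_mul _).add
      ((S.isLipschitz_u j).mul_const _)
  · exact ((((S.isLipschitz_pM j).sub ((S.isLipschitz_u j).const_mul _)).sub
      ((S.isLipschitz_omega _).const_mul _)).add (IsLipschitz.sum _ fun i =>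
        (((S.isLipschitz_pc i).sub (S.isLipschitz_pc j)).const_mul _).ite_zero _)).div_const _

end Lipschitz

theorem exists_isSolution (s : S.State) : ∃ φ, S.IsSolution φ ∧ (φ 0).state = s := by
  obtain ⟨K, hK⟩ := S.isLipschitz_field
  obtain ⟨σ, h0, hσ⟩ := hK.exists_forall_hasDerivAt S.contDiff_field s
  exact ⟨_, S.isSolution_of_hasDerivAt hσ, by rw [S.toPoint_state, h0]⟩

end PowerSystem

/-- The potential energy `∫_a^x (sin θ - sin a) dθ` of a line. -/
noncomputable def linePotential (a x : ℝ) : ℝ := Real.cos a - Real.cos x - Real.sin a * (x - a)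

/-- By the mean value theorem the potential is (sin c - sin a)(x - a) with c between a and x, and
sine is strictly increasing there. -/
theorem linePotential_pos {a x : ℝ} (ha : |a| < Real.pi / 2) (hx : |x| < Real.pi / 2)
    (hne : x ≠ a) : 0 < linePotential a x := by
  rw [abs_lt] at ha hx
  have hd : ∀ y, HasDerivAt Real.cos (-Real.sin y) y := Real.hasDerivAt_cos
  rcases lt_or_gt_of_ne hne with h | h
  · obtain ⟨c, hc, he⟩ := exists_hasDerivAt_eq_slope Real.cos (fun y => -Real.sin y) h
      Real.continuous_cos.continuousOn (fun y _ => hd y)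
    have hs := Real.strictMonoOn_sin (a := c) (b := a) ⟨by linarith [hc.1], by linarith [hc.2]⟩
      ⟨by linarith, by linarith⟩ hc.2
    rw [eq_div_iff (by linarith)] at he
    unfold linePotential
    nlinarith
  · obtain ⟨c, hc, he⟩ := exists_hasDerivAt_eq_slope Real.cos (fun y => -Real.sin y) h
      Real.continuous_cos.continuousOn (fun y _ => hd y)
    have hs := Real.strictMonoOn_sin (a := a) (b := c) ⟨by linarith, by linarith⟩
      ⟨by linarith [hc.1], by linarith [hc.2]⟩ hc.1
    rw [eq_div_iff (by linarith)] at he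
    unfold linePotential
    nlinarith

theorem linePotential_self (a : ℝ) : linePotential a a = 0 := by simp [linePotential]

theorem linePotential_nonneg {a x : ℝ} (ha : |a| < Real.pi / 2) (hx : |x| < Real.pi / 2) :
    0 ≤ linePotential a x := by
  rcases eq_or_ne x a with rfl | hne
  · rw [linePotential_self]
  · exact (linePotential_pos ha hx hne).le

theorem hasDerivAt_linePotential (a x : ℝ) :
    HasDerivAt (linePotential a) (Real.sin x - Real.sin a) x := by
  refine (((Real.hasDerivAt_cos x).const_sub (Real.cos a)).sub
    (((hasDerivAt_id x).sub_const a).const_mul (Real.sin a))).congr_deriv ?_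
  simp

theorem Matrix.hasDerivWithinAt_quadratic {n : ℕ} {P : Matrix (Fin n) (Fin n) ℝ} (hP : Pᵀ = P)
    {x : ℝ → Fin n → ℝ} {x' : Fin n → ℝ} {s : Set ℝ} {t : ℝ} (h : HasDerivWithinAt x x' s t) :
    HasDerivWithinAt (fun r => 1 / 2 * (x r ⬝ᵥ (P *ᵥ x r))) (x t ⬝ᵥ (P *ᵥ x')) s t := by
  have h1 := hasDerivWithinAt_pi.1 h
  have h2 : HasDerivWithinAt (fun r => x r ⬝ᵥ (P *ᵥ x r))
      (∑ i, (x' i * (P *ᵥ x t) i + x t i * (P *ᵥ x') i)) s t := by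
    refine HasDerivWithinAt.fun_sum fun i _ => (h1 i).mul ?_
    change HasDerivWithinAt (fun r => ∑ k, P i k * x r k) (∑ k, P i k * x' k) s t
    exact HasDerivWithinAt.fun_sum fun k _ => (h1 k).const_mul (P i k)
  refine (h2.const_mul (1 / 2)).congr_deriv ?_
  rw [Finset.sum_add_distrib]
  change 1 / 2 * (x' ⬝ᵥ P *ᵥ x t + x t ⬝ᵥ P *ᵥ x') = _
  rw [Matrix.dotProduct_mulVec x', ← Matrix.mulVec_transpose, hP, dotProduct_comm]
  ring

/-! ### The energy as a Lyapunov function -/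

namespace PowerSystem

variable {G L : Type*} [Fintype G] [Fintype L] (S : PowerSystem G L)

/-- The energy of the dynamic states relative to an equilibrium. -/
noncomputable def energy (βs : S.Point) (P : ∀ j, Matrix (Fin (S.n j)) (Fin (S.n j)) ℝ)
    (β : S.Point) : ℝ :=
  ∑ e, S.b e * linePotential (βs.eta e) (β.eta e)
    + ∑ j, S.M j * (1 / 2 * β.omega (Sum.inl j) ^ 2)
    + ∑ j, S.γ j * (1 / 2 * (β.pc j - βs.pc j) ^ 2)
    + ∑ j, 1 / 2 * ((β.xM j - βs.xM j) ⬝ᵥ (P j *ᵥ (β.xM j - βs.xM j)))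

/-- The rate of change of the energy along solutions. -/
noncomputable def energyRate (βs : S.Point) (P : ∀ j, Matrix (Fin (S.n j)) (Fin (S.n j)) ℝ)
    (β : S.Point) : ℝ :=
  ∑ e, S.b e * ((Real.sin (β.eta e) - Real.sin (βs.eta e)) * β.etaRate e)
    + ∑ j, β.omega (Sum.inl j) * β.genBalance j
    + ∑ j, (β.pc j - βs.pc j) * β.pcDrive j
    + ∑ j, (β.xM j - βs.xM j) ⬝ᵥ (P j *ᵥ β.xMRate j)

theorem continuous_eta (e : S.E) : Continuous fun σ : S.State => (S.toPoint σ).eta e := by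
  change Continuous fun σ : S.State => σ.1 e
  fun_prop

variable {S} {βs : S.Point} {P : ∀ j, Matrix (Fin (S.n j)) (Fin (S.n j)) ℝ}

theorem IsSolution.hasDerivWithinAt_energy {φ : ℝ → S.Point} (h : S.IsSolution φ)
    (hP : ∀ j, (P j).PosDef) {t : ℝ} (ht : 0 ≤ t) :
    HasDerivWithinAt (fun s => S.energy βs P (φ s)) (S.energyRate βs P (φ t)) (Set.Ici 0) t := by
  refine (((HasDerivWithinAt.fun_sum fun e _ => ?_).add
    (HasDerivWithinAt.fun_sum fun j _ => ?_)).add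
    (HasDerivWithinAt.fun_sum fun j _ => ?_)).add (HasDerivWithinAt.fun_sum fun j _ => ?_)
  · exact ((hasDerivAt_linePotential _ _).comp_hasDerivWithinAt t (h.eta t ht e)).const_mul _
  · refine ((((h.omega t ht j).pow 2).const_mul (1 / 2)).const_mul (S.M j)).congr_deriv ?_
    have := (S.M_pos j).ne'
    push_cast
    field_simp
  · refine (((((h.pc t ht j).sub_const (βs.pc j)).pow 2).const_mul (1 / 2)).const_mul
      (S.γ j)).congr_deriv ?_
    have := (S.γ_pos j).ne'
    push_cast
    field_simp
  · exact Matrix.hasDerivWithinAt_quadratic (by simpa using (hP j).isHermitian.eq)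
      ((h.xM t ht j).sub_const _)

-- Line potentials return the power that the network takes from the inertial buses, and at the other
-- buses the algebraic balance turns it into damping. The rest splits into one design inequality per
-- bus, in deviations from equilibrium, plus the Laplacian form of the power commands.
open scoped Classical in
theorem energyRate_le (hs : S.IsEquilibrium βs) {Λh : G → ℝ} (hP : ∀ j, (P j).PosDef)
    (hD : ∀ j, (-(S.designMatrix j (P j) (Λh j))).PosSemidef) {β : S.Point}
    (hβ : ∀ j, β.loadBalance j = 0) :
    S.energyRate βs P β ≤ -(∑ j, (S.Λ (Sum.inl j) - Λh j) * β.omega (Sum.inl j) ^ 2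
      + ∑ j, S.Λ (Sum.inr j) * β.omega (Sum.inr j) ^ 2
      + 1 / 2 * ∑ j, ∑ i, if S.comm.Adj i j then S.α i j * (β.pc i - β.pc j) ^ 2 else 0) := by
  have hω := hs.omega_eq_zero
  have hA : ∑ e, S.b e * ((Real.sin (β.eta e) - Real.sin (βs.eta e)) * β.etaRate e)
      = ∑ j, β.omega (Sum.inl j) * (βs.netFlow (Sum.inl j) - β.netFlow (Sum.inl j))
        - ∑ j, S.Λ (Sum.inr j) * β.omega (Sum.inr j) ^ 2 := by
    have h1 := sum_mul_netFlow β β.omega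
    have h2 := sum_mul_netFlow βs β.omega
    have h3 : ∑ e, S.b e * ((Real.sin (β.eta e) - Real.sin (βs.eta e)) * β.etaRate e)
        = ∑ i, β.omega i * (βs.netFlow i - β.netFlow i) := by
      simp only [mul_sub, Finset.sum_sub_distrib] at h1 h2 ⊢
      rw [h1, h2]
      simp only [Point.flow, Point.etaRate, sub_mul, mul_sub, Finset.sum_sub_distrib, mul_assoc]
      ring
    rw [h3, Fintype.sum_sum_type, sub_eq_add_neg, ← Finset.sum_neg_distrib]
    congr 1
    refine Finset.sum_congr rfl fun j _ => ?_
    have h4 := hβ j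
    have h5 := hs.load j
    rw [Point.loadBalance] at h4 h5
    rw [hω, Pi.zero_apply, mul_zero] at h5
    have h6 : βs.netFlow (Sum.inr j) - β.netFlow (Sum.inr j)
        = -(S.Λ (Sum.inr j) * β.omega (Sum.inr j)) := by linarith
    rw [h6]
    ring
  have hC := sum_mul_comm (S := S) β.pc (fun j => β.pc j - βs.pc j)
  have hC' : ∀ i j, (β.pc i - βs.pc i) - (β.pc j - βs.pc j) = β.pc i - β.pc j := by
    intro i j
    rw [hs.pc_eq i j]
    ring
  simp only [hC', ← sq] at hC
  have hsc : ∀ j, ∑ i, (if S.comm.Adj i j then S.α i j * (βs.pc i - βs.pc j) else 0) = 0 :=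
    fun j => Finset.sum_eq_zero fun i _ => by rw [hs.pc_eq i j, sub_self, mul_zero, ite_self]
  have hbus : ∀ j, β.omega (Sum.inl j) * (βs.netFlow (Sum.inl j) - β.netFlow (Sum.inl j))
      + β.omega (Sum.inl j) * β.genBalance j + (β.pc j - βs.pc j) * β.pcDrive j
      + (β.xM j - βs.xM j) ⬝ᵥ (P j *ᵥ β.xMRate j)
      ≤ -((S.Λ (Sum.inl j) - Λh j) * β.omega (Sum.inl j) ^ 2) + (β.pc j - βs.pc j) *
        ∑ i, (if S.comm.Adj i j then S.α i j * (β.pc i - β.pc j) else 0) := by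
    intro j
    have h1 := S.design_inequality (hP j) (hD j) (β.pc j - βs.pc j) (β.omega (Sum.inl j))
      (β.xM j - βs.xM j)
    have hu : S.kc j * (β.pc j - βs.pc j) - S.kd j * β.omega (Sum.inl j) = β.u j - βs.u j := by
      rw [Point.u, Point.u, hω, Pi.zero_apply]
      ring
    have hx : S.A j *ᵥ (β.xM j - βs.xM j) + (β.u j - βs.u j) • S.B j = β.xMRate j := by
      have h2 := hs.xM j
      rw [Point.xMRate] at h2 ⊢
      rw [Matrix.mulVec_sub, sub_smul, ← sub_zero (S.A j *ᵥ β.xM j + β.u j • S.B j), ← h2]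
      abel
    have hp : S.C j ⬝ᵥ (β.xM j - βs.xM j) + S.D j * (β.u j - βs.u j) = β.pM j - βs.pM j := by
      rw [Point.pM, Point.pM, dotProduct_sub]
      ring
    rw [hu, hx, hp] at h1
    have h3 := hs.omega j
    have h4 := hs.pc j
    rw [Point.genBalance, hω, Pi.zero_apply, mul_zero] at h3
    rw [Point.pcDrive, hω, Pi.zero_apply, mul_zero, hsc j] at h4
    have h5 : β.genBalance j = β.pM j - βs.pM j - S.Λ (Sum.inl j) * β.omega (Sum.inl j)
        + (β.netFlow (Sum.inl j) - βs.netFlow (Sum.inl j)) := by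
      rw [Point.genBalance]
      linarith
    have h6 : β.pcDrive j = (β.pM j - βs.pM j - S.K j * (β.u j - βs.u j)
        - S.kf j * β.omega (Sum.inl j))
        + ∑ i, (if S.comm.Adj i j then S.α i j * (β.pc i - β.pc j) else 0) := by
      rw [Point.pcDrive]
      linarith
    rw [h5, h6]
    linarith
  have hsum := Finset.sum_le_sum fun j (_ : j ∈ Finset.univ) => hbus j
  simp only [Finset.sum_add_distrib, Finset.sum_neg_distrib] at hsum
  rw [hC] at hsum
  rw [energyRate, hA]
  linarith

theorem energy_self (hs : S.IsEquilibrium βs) : S.energy βs P βs = 0 := by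
  simp [energy, linePotential_self, hs.omega_eq_zero]

theorem energy_toPoint_state (β : S.Point) :
    S.energy βs P (S.toPoint β.state) = S.energy βs P β := rfl

theorem energy_pos (hs : S.IsEquilibrium βs) (hP : ∀ j, (P j).PosDef)
    (hangle : ∀ e, |βs.eta e| < Real.pi / 2) {β : S.Point}
    (hβ : ∀ e, |β.eta e| < Real.pi / 2) (hne : β.state ≠ βs.state) :
    0 < S.energy βs P β := by
  have n1 : ∀ e, 0 ≤ S.b e * linePotential (βs.eta e) (β.eta e) := fun e =>
    mul_nonneg (S.b_pos e).le (linePotential_nonneg (hangle e) (hβ e))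
  have n2 : ∀ j, 0 ≤ S.M j * (1 / 2 * β.omega (Sum.inl j) ^ 2) := fun j => by
    have := S.M_pos j
    positivity
  have n3 : ∀ j, 0 ≤ S.γ j * (1 / 2 * (β.pc j - βs.pc j) ^ 2) := fun j => by
    have := S.γ_pos j
    positivity
  have n4 : ∀ j, 0 ≤ 1 / 2 * ((β.xM j - βs.xM j) ⬝ᵥ (P j *ᵥ (β.xM j - βs.xM j))) := fun j => by
    have := (hP j).posSemidef.dotProduct_mulVec_nonneg (β.xM j - βs.xM j)
    rw [star_trivial] at this
    positivity
  by_contra hle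
  rw [energy] at hle
  have s1 := Finset.sum_nonneg fun e (_ : e ∈ Finset.univ) => n1 e
  have s2 := Finset.sum_nonneg fun j (_ : j ∈ Finset.univ) => n2 j
  have s3 := Finset.sum_nonneg fun j (_ : j ∈ Finset.univ) => n3 j
  have s4 := Finset.sum_nonneg fun j (_ : j ∈ Finset.univ) => n4 j
  have z1 := (Finset.sum_eq_zero_iff_of_nonneg fun e _ => n1 e).1 (by linarith)
  have z2 := (Finset.sum_eq_zero_iff_of_nonneg fun e _ => n2 e).1 (by linarith)
  have z3 := (Finset.sum_eq_zero_iff_of_nonneg fun e _ => n3 e).1 (by linarith)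
  have z4 := (Finset.sum_eq_zero_iff_of_nonneg fun e _ => n4 e).1 (by linarith)
  refine hne (Prod.ext (funext fun e => ?_) (Prod.ext (funext fun j => ?_)
    (Prod.ext (funext fun j => ?_) (funext fun j => ?_))))
  · by_contra h
    exact (mul_pos (S.b_pos e) (linePotential_pos (hangle e) (hβ e) h)).ne'
      (z1 e (Finset.mem_univ _))
  · change β.omega (Sum.inl j) = βs.omega (Sum.inl j)
    have := z2 j (Finset.mem_univ _)
    rw [hs.omega_eq_zero, Pi.zero_apply]
    simpa [(S.M_pos j).ne'] using this
  · change β.xM j = βs.xM j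
    by_contra h
    have := (hP j).dotProduct_mulVec_pos (sub_ne_zero.2 h)
    rw [star_trivial] at this
    exact absurd (z4 j (Finset.mem_univ _)) (by positivity)
  · change β.pc j = βs.pc j
    have := z3 j (Finset.mem_univ _)
    rw [← sub_eq_zero]
    simpa [(S.γ_pos j).ne'] using this

theorem energy_nonneg (hs : S.IsEquilibrium βs) (hP : ∀ j, (P j).PosDef)
    (hangle : ∀ e, |βs.eta e| < Real.pi / 2) {β : S.Point}
    (hβ : ∀ e, |β.eta e| < Real.pi / 2) : 0 ≤ S.energy βs P β := by
  by_cases h : β.state = βs.state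
  · rw [← energy_toPoint_state, h, energy_toPoint_state, energy_self hs]
  · exact (energy_pos hs hP hangle hβ h).le

theorem continuous_energy : Continuous fun σ : S.State => S.energy βs P (S.toPoint σ) := by
  have hx : ∀ j, Continuous fun σ : S.State => (S.toPoint σ).xM j := fun j =>
    continuous_pi fun k => (S.contDiff_xM j k).continuous
  have hl : ∀ a, Continuous (linePotential a) := fun a => by
    unfold linePotential
    fun_prop
  refine (((continuous_finsetSum _ fun e _ => ?_).add
    (continuous_finsetSum _ fun j _ => ?_)).add (continuous_finsetSum _ fun j _ => ?_)).add
    (continuous_finsetSum _ fun j _ => ?_)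
  · exact continuous_const.mul ((hl _).comp (S.continuous_eta e))
  · exact continuous_const.mul (continuous_const.mul ((S.contDiff_omega _).continuous.pow 2))
  · exact continuous_const.mul (continuous_const.mul
      (((S.contDiff_pc j).continuous.sub continuous_const).pow 2))
  · exact continuous_const.mul (((hx j).sub continuous_const).dotProduct
      (continuous_const.matrix_mulVec ((hx j).sub continuous_const)))

theorem continuous_energyRate :
    Continuous fun σ : S.State => S.energyRate βs P (S.toPoint σ) := by
  have hx : ∀ j, Continuous fun σ : S.State => (S.toPoint σ).xM j := fun j =>
    continuous_pi fun k => (S.contDiff_xM j k).continuous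
  refine (((continuous_finsetSum _ fun e _ => ?_).add
    (continuous_finsetSum _ fun j _ => ?_)).add (continuous_finsetSum _ fun j _ => ?_)).add
    (continuous_finsetSum _ fun j _ => ?_)
  · exact continuous_const.mul (((Real.continuous_sin.comp (S.continuous_eta e)).sub
      continuous_const).mul (S.contDiff_etaRate e).continuous)
  · exact (S.contDiff_omega _).continuous.mul (S.contDiff_genBalance j).continuous
  · exact ((S.contDiff_pc j).continuous.sub continuous_const).mul (S.contDiff_pcDrive j).continuous
  · exact ((hx j).sub continuous_const).dotProduct
      (continuous_const.matrix_mulVec (S.contDiff_xMRate j).continuous)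

end PowerSystem

/-! ### Asymptotic tools for bounded trajectories -/

-- The field is bounded on the compact set, so the trajectory is Lipschitz in time; F is uniformly
-- continuous there. This supplies the hypothesis of Barbalat's lemma.
open Set Filter in
theorem IsCompact.uniformContinuousOn_comp_solution {V : Type*} [NormedAddCommGroup V]
    [NormedSpace ℝ V] {s : Set V} (hs : IsCompact s) {f : V → V} (hf : Continuous f) {σ : ℝ → V}
    (hσ : ∀ t, 0 ≤ t → HasDerivWithinAt σ (f (σ t)) (Ici 0) t) (hmem : ∀ t, 0 ≤ t → σ t ∈ s)
    {F : V → ℝ} (hF : Continuous F) : UniformContinuousOn (fun t => F (σ t)) (Ici 0) := by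
  obtain ⟨C, hC⟩ := hs.exists_bound_of_continuousOn hf.continuousOn
  have hL : LipschitzOnWith C.toNNReal σ (Ici 0) :=
    Convex.lipschitzOnWith_of_nnnorm_hasDerivWithin_le (convex_Ici 0) hσ fun t ht => by
      rw [← NNReal.coe_le_coe, coe_nnnorm]
      exact (hC _ (hmem t ht)).trans (Real.le_coe_toNNReal C)
  exact (hs.uniformContinuousOn_of_continuous hF.continuousOn).comp hL.uniformContinuousOn hmem

open Set Filter in
theorem exists_tendsto_of_antitoneOn_Ici {f : ℝ → ℝ} (hf : AntitoneOn f (Ici 0))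
    (h0 : ∀ t, 0 ≤ t → 0 ≤ f t) : ∃ l, Tendsto f atTop (𝓝 l) := by
  have h1 : Antitone fun t => f (max t 0) := fun s t hst =>
    hf (le_max_right s 0) (le_max_right t 0) (max_le_max_right 0 hst)
  have h2 := tendsto_atTop_ciInf h1
    ⟨0, by rintro _ ⟨t, rfl⟩; exact h0 _ (le_max_right t 0)⟩
  refine ⟨_, h2.congr' ?_⟩
  filter_upwards [eventually_ge_atTop 0] with t ht
  rw [max_eq_left ht]

open Set Filter in
theorem tendsto_zero_of_mul_sq_le {f h : ℝ → ℝ} {c : ℝ} (hc : 0 < c)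
    (hle : ∀ t, 0 ≤ t → c * f t ^ 2 ≤ h t) (hh : Tendsto h atTop (𝓝 0)) :
    Tendsto f atTop (𝓝 0) := by
  have h1 : Tendsto (fun t => f t ^ 2) atTop (𝓝 0) := by
    refine squeeze_zero' (Eventually.of_forall fun t => sq_nonneg _) ?_
      (by simpa using hh.div_const c)
    filter_upwards [eventually_ge_atTop 0] with t ht
    rw [le_div_iff₀ hc, mul_comm]
    exact hle t ht
  have h2 := h1.sqrt
  simp only [Real.sqrt_sq_eq_abs, Real.sqrt_zero] at h2
  exact (tendsto_zero_iff_abs_tendsto_zero f).2 h2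

open Set Filter in
theorem tendsto_sum_mul_zero {ι : Type*} [Fintype ι] (c : ι → ℝ) {f : ι → ℝ → ℝ}
    (h : ∀ i, Tendsto (f i) atTop (𝓝 0)) :
    Tendsto (fun t => ∑ i, c i * f i t) atTop (𝓝 0) := by
  simpa using tendsto_finsetSum Finset.univ fun i _ => (h i).const_mul (c i)

open Set Filter in
theorem tendsto_zero_of_hasDerivWithinAt_neg_mul_add {y g : ℝ → ℝ} {a : ℝ} (ha : 0 < a)
    (hy : ∀ t, 0 ≤ t → HasDerivWithinAt y (-a * y t + g t) (Ici 0) t)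
    (hg : Tendsto g atTop (𝓝 0)) : Tendsto y atTop (𝓝 0) := by
  have h : Tendsto (fun t => (y t : ℂ)) atTop (𝓝 0) := by
    refine tendsto_zero_of_hasDerivWithinAt_mul_add (z := -a) (g := fun t => (g t : ℂ))
      (by simpa using ha) (fun t ht => ?_) ?_
    · exact (Complex.ofRealCLM.hasFDerivAt.comp_hasDerivWithinAt t (hy t ht)).congr_deriv
        (by simp)
    · simpa using! (Complex.continuous_ofReal.tendsto _).comp hg
  simpa using! (Complex.continuous_re.tendsto _).comp h

/-! ### Trapping and convergence of solutions -/

namespace PowerSystem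

variable {G L : Type*} [Fintype G] [Fintype L] {S : PowerSystem G L} {βs : S.Point}
  {P : ∀ j, Matrix (Fin (S.n j)) (Fin (S.n j)) ℝ}

open Set Filter

theorem energy_antitoneOn (hs : S.IsEquilibrium βs) {Λh : G → ℝ} (hP : ∀ j, (P j).PosDef)
    (hΛ : ∀ j, Λh j < S.Λ (Sum.inl j))
    (hD : ∀ j, (-(S.designMatrix j (P j) (Λh j))).PosSemidef) {φ : ℝ → S.Point}
    (h : S.IsSolution φ) : AntitoneOn (fun t => S.energy βs P (φ t)) (Ici 0) := by
  classical
  refine antitoneOn_Ici_of_hasDerivWithinAt_nonpos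
    (fun t ht => h.hasDerivWithinAt_energy hP ht) fun t ht => ?_
  refine (energyRate_le hs hP hD (h.load t ht)).trans (neg_nonpos.2 ?_)
  refine add_nonneg (add_nonneg (Finset.sum_nonneg fun j _ => ?_)
    (Finset.sum_nonneg fun j _ => ?_)) (mul_nonneg (by norm_num)
    (Finset.sum_nonneg fun j _ => Finset.sum_nonneg fun i _ => ?_))
  · exact mul_nonneg (sub_nonneg.2 (hΛ j).le) (sq_nonneg _)
  · exact mul_nonneg (S.Λ_load_pos j).le (sq_nonneg _)
  · split_ifs with hij
    · exact mul_nonneg (S.α_pos i j hij).le (sq_nonneg _)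
    · exact le_rfl

/-- A closed ball around a stable equilibrium, and a neighbourhood from which no solution leaves
it. -/
theorem exists_trapping_neighborhood (hs : S.IsEquilibrium βs)
    (hangle : ∀ e, |βs.eta e| < Real.pi / 2) {Λh : G → ℝ} (hP : ∀ j, (P j).PosDef)
    (hΛ : ∀ j, Λh j < S.Λ (Sum.inl j))
    (hD : ∀ j, (-(S.designMatrix j (P j) (Λh j))).PosSemidef) :
    ∃ s U : Set S.State, IsCompact s ∧ (∀ σ ∈ s, ∀ e, |σ.1 e| < Real.pi / 2) ∧
      IsOpen U ∧ βs.state ∈ U ∧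
      ∀ φ, S.IsSolution φ → (φ 0).state ∈ U → ∀ t, 0 ≤ t → (φ t).state ∈ s := by
  have hopen : IsOpen {σ : S.State | ∀ e, |σ.1 e| < Real.pi / 2} := by
    simp only [ofPred_forall]
    exact isOpen_iInter_of_finite fun e =>
      isOpen_lt (continuous_abs.comp (S.continuous_eta e)) continuous_const
  obtain ⟨r, hr, hball⟩ := Metric.nhds_basis_closedBall.mem_iff.1
    (hopen.mem_nhds (show βs.state ∈ {σ : S.State | ∀ e, |σ.1 e| < Real.pi / 2} from hangle))
  have hpos : ∀ σ ∈ Metric.sphere βs.state r, 0 < S.energy βs P (S.toPoint σ) := fun σ hσ =>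
    energy_pos hs hP hangle (hball (Metric.sphere_subset_closedBall hσ)) fun he => by
      rw [S.toPoint_state] at he
      rw [he, Metric.mem_sphere, dist_self] at hσ
      exact hr.ne hσ
  -- The energy is at least m > 0 on the sphere. A solution starting inside with energy below m
  -- would have to cross the sphere to escape, which nonincreasing energy forbids.
  obtain ⟨m, hm, hmin⟩ := (isCompact_sphere βs.state r).exists_forall_le'
    (continuous_energy (P := P)).continuousOn hpos
  refine ⟨Metric.closedBall βs.state r,
    Metric.ball βs.state r ∩ {σ | S.energy βs P (S.toPoint σ) < m},
    isCompact_closedBall _ _, hball,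
    Metric.isOpen_ball.inter (isOpen_lt continuous_energy continuous_const),
    ⟨Metric.mem_ball_self hr, ?_⟩, fun φ hφ h0 t ht => ?_⟩
  · rw [mem_ofPred_eq, energy_toPoint_state, energy_self hs]
    exact hm
  · by_contra hout
    have hcont : ContinuousOn (fun t => dist (φ t).state βs.state) (Icc 0 t) := fun s hs' =>
      ((hφ.hasDerivWithinAt_state hs'.1).continuousWithinAt.mono Icc_subset_Ici_self).dist
        continuousWithinAt_const
    obtain ⟨s, hs', he⟩ := intermediate_value_Icc ht hcont
      ⟨(Metric.mem_ball.1 h0.1).le, (not_le.1 hout).le⟩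
    have h1 := hmin _ (Metric.mem_sphere.2 he)
    rw [energy_toPoint_state] at h1
    have h2 := energy_antitoneOn hs hP hΛ hD hφ (mem_Ici.2 le_rfl) (mem_Ici.2 hs'.1) hs'.1
    have h3 := h0.2
    rw [mem_ofPred_eq, energy_toPoint_state] at h3
    exact absurd (h1.trans h2) (not_le.2 h3)

namespace IsSolution

variable {φ : ℝ → S.Point} {s : Set S.State}

theorem uniformContinuousOn (h : S.IsSolution φ) (hc : IsCompact s)
    (hmem : ∀ t, 0 ≤ t → (φ t).state ∈ s) {F : S.Point → ℝ}
    (hF : Continuous fun σ => F (S.toPoint σ)) :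
    UniformContinuousOn (fun t => F (φ t)) (Ici 0) := by
  refine (hc.uniformContinuousOn_comp_solution S.contDiff_field.continuous
    (fun t ht => h.hasDerivWithinAt_state ht) hmem hF).congr fun t ht => ?_
  simp only [h.toPoint_state ht]

theorem tendsto_energyRate (h : S.IsSolution φ) (hc : IsCompact s)
    (hmem : ∀ t, 0 ≤ t → (φ t).state ∈ s) (hangle : ∀ σ ∈ s, ∀ e, |σ.1 e| < Real.pi / 2)
    (hs : S.IsEquilibrium βs) (hsangle : ∀ e, |βs.eta e| < Real.pi / 2)
    {Λh : G → ℝ} (hP : ∀ j, (P j).PosDef) (hΛ : ∀ j, Λh j < S.Λ (Sum.inl j))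
    (hD : ∀ j, (-(S.designMatrix j (P j) (Λh j))).PosSemidef) :
    Tendsto (fun t => S.energyRate βs P (φ t)) atTop (𝓝 0) := by
  obtain ⟨l, hl⟩ := exists_tendsto_of_antitoneOn_Ici (energy_antitoneOn hs hP hΛ hD h)
    fun t ht => energy_nonneg hs hP hsangle (hangle _ (hmem t ht))
  exact tendsto_deriv_zero_of_uniformContinuousOn
    (fun t ht => h.hasDerivWithinAt_energy hP ht) hl
    (h.uniformContinuousOn hc hmem continuous_energyRate)

/-- Each nonnegative term of the dissipation is at most minus the energy rate, hence vanishes;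
connectedness carries consensus from communication links to all pairs. -/
theorem tendsto_omega_and_pc_sub (h : S.IsSolution φ) (hs : S.IsEquilibrium βs)
    {Λh : G → ℝ} (hP : ∀ j, (P j).PosDef) (hΛ : ∀ j, Λh j < S.Λ (Sum.inl j))
    (hD : ∀ j, (-(S.designMatrix j (P j) (Λh j))).PosSemidef)
    (hrate : Tendsto (fun t => S.energyRate βs P (φ t)) atTop (𝓝 0)) :
    (∀ i, Tendsto (fun t => (φ t).omega i) atTop (𝓝 0)) ∧
      ∀ i j, Tendsto (fun t => (φ t).pc i - (φ t).pc j) atTop (𝓝 0) := by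
  classical
  have hr : Tendsto (fun t => -S.energyRate βs P (φ t)) atTop (𝓝 0) := by simpa using hrate.neg
  have n1 : ∀ t j, 0 ≤ (S.Λ (Sum.inl j) - Λh j) * (φ t).omega (Sum.inl j) ^ 2 := fun t j =>
    mul_nonneg (sub_nonneg.2 (hΛ j).le) (sq_nonneg _)
  have n2 : ∀ t j, 0 ≤ S.Λ (Sum.inr j) * (φ t).omega (Sum.inr j) ^ 2 := fun t j =>
    mul_nonneg (S.Λ_load_pos j).le (sq_nonneg _)
  have n3 : ∀ t j i, 0 ≤ if S.comm.Adj i j then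
      S.α i j * ((φ t).pc i - (φ t).pc j) ^ 2 else 0 := fun t j i => by
    split_ifs with hij
    · exact mul_nonneg (S.α_pos i j hij).le (sq_nonneg _)
    · exact le_rfl
  have s1 := fun t => Finset.sum_nonneg fun j (_ : j ∈ Finset.univ) => n1 t j
  have s2 := fun t => Finset.sum_nonneg fun j (_ : j ∈ Finset.univ) => n2 t j
  have s3 := fun t => Finset.sum_nonneg fun j (_ : j ∈ Finset.univ) =>
    Finset.sum_nonneg fun i (_ : i ∈ Finset.univ) => n3 t j i
  refine ⟨fun i => ?_, fun i j => ?_⟩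
  · rcases i with j | j
    · refine tendsto_zero_of_mul_sq_le (sub_pos.2 (hΛ j)) (fun t ht => ?_) hr
      have h1 := energyRate_le hs hP hD (h.load t ht)
      have h2 := Finset.single_le_sum (fun j _ => n1 t j) (Finset.mem_univ j)
      linarith [s2 t, s3 t]
    · refine tendsto_zero_of_mul_sq_le (S.Λ_load_pos j) (fun t ht => ?_) hr
      have h1 := energyRate_le hs hP hD (h.load t ht)
      have h2 := Finset.single_le_sum (fun j _ => n2 t j) (Finset.mem_univ j)
      linarith [s1 t, s3 t]
  · refine S.comm_connected.rel_of_adj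
      (r := fun i j => Tendsto (fun t => (φ t).pc i - (φ t).pc j) atTop (𝓝 0))
      (fun _ => by simp) (fun a b c hab hbc => by simpa using hab.add hbc) (fun i j hij => ?_) i j
    refine tendsto_zero_of_mul_sq_le (c := 1 / 2 * S.α i j)
      (by have := S.α_pos i j hij; positivity) (fun t ht => ?_) hr
    have h1 := energyRate_le hs hP hD (h.load t ht)
    have h2 := Finset.single_le_sum
      (fun j _ => Finset.sum_nonneg fun i (_ : i ∈ Finset.univ) => n3 t j i) (Finset.mem_univ j)
    have h3 := Finset.single_le_sum (fun i _ => n3 t j i) (Finset.mem_univ i)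
    rw [if_pos hij] at h3
    linarith [s1 t, s2 t]

/-- Second use of Barbalat's lemma: ω converges and its derivative is uniformly continuous, so the
derivative vanishes in the limit. -/
theorem tendsto_genBalance (h : S.IsSolution φ) (hc : IsCompact s)
    (hmem : ∀ t, 0 ≤ t → (φ t).state ∈ s)
    (hω : ∀ i, Tendsto (fun t => (φ t).omega i) atTop (𝓝 0)) (j : G) :
    Tendsto (fun t => (φ t).genBalance j) atTop (𝓝 0) := by
  have h1 := tendsto_deriv_zero_of_uniformContinuousOn (fun t ht => h.omega t ht j)
    (hω (Sum.inl j)) (h.uniformContinuousOn hc hmem (F := fun β => β.genBalance j / S.M j)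
      ((S.contDiff_genBalance j).continuous.div_const _))
  have h2 := h1.mul_const (S.M j)
  simpa [div_mul_cancel₀ _ (S.M_pos j).ne'] using h2

/-- Consensus leaves one scalar unknown. The total power balance replaces total generation by fixed
demand plus vanishing terms, which removes the generation states from the summed controller
equations. What remains for the γ-weighted deviation is a linear equation of rate -κ/Γ with
vanishing forcing. -/
theorem tendsto_pc (h : S.IsSolution φ) (hs : S.IsEquilibrium βs)
    (hK : ∀ j, 0 < S.K j * S.kc j)
    (hω : ∀ i, Tendsto (fun t => (φ t).omega i) atTop (𝓝 0))
    (hpc : ∀ i j, Tendsto (fun t => (φ t).pc i - (φ t).pc j) atTop (𝓝 0))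
    (hgen : ∀ j, Tendsto (fun t => (φ t).genBalance j) atTop (𝓝 0)) (j : G) :
    Tendsto (fun t => (φ t).pc j) atTop (𝓝 (βs.pc j)) := by
  have hne : (Finset.univ : Finset G).Nonempty := ⟨j, Finset.mem_univ j⟩
  set κ := ∑ i, S.K i * S.kc i with hκ
  set Γ := ∑ i, S.γ i with hΓ
  have hκ0 : 0 < κ := Finset.sum_pos (fun i _ => hK i) hne
  have hΓ0 : 0 < Γ := Finset.sum_pos (fun i _ => S.γ_pos i) hne
  have hd : Tendsto (fun t => ∑ i, S.γ i * ((φ t).pc i - (φ t).pc j)) atTop (𝓝 0) :=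
    tendsto_sum_mul_zero _ fun i => hpc i j
  have hW : ∀ t, ∑ i, S.γ i * ((φ t).pc i - βs.pc i)
      = Γ * ((φ t).pc j - βs.pc j) + ∑ i, S.γ i * ((φ t).pc i - (φ t).pc j) := by
    intro t
    rw [hΓ, Finset.sum_mul, ← Finset.sum_add_distrib]
    refine Finset.sum_congr rfl fun i _ => ?_
    rw [hs.pc_eq i j]
    ring
  have hKs : ∀ t, ∑ i, S.K i * S.kc i * ((φ t).pc i - βs.pc i)
      = κ * ((φ t).pc j - βs.pc j) + ∑ i, S.K i * S.kc i * ((φ t).pc i - (φ t).pc j) := by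
    intro t
    rw [hκ, Finset.sum_mul, ← Finset.sum_add_distrib]
    refine Finset.sum_congr rfl fun i _ => ?_
    rw [hs.pc_eq i j]
    ring
  -- Total demand equals equilibrium generation, ∑ K kc pc*, so only deviations and vanishing terms
  -- survive.
  have hdrive : ∀ t, 0 ≤ t → ∑ i, (φ t).pcDrive i = -∑ i, S.K i * S.kc i * ((φ t).pc i - βs.pc i)
      + (∑ i, 1 * (φ t).genBalance i + ∑ i, S.Λ i * (φ t).omega i
        + ∑ i, (S.K i * S.kd i - S.kf i) * (φ t).omega (Sum.inl i)) := by
    intro t ht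
    have h1 := sum_pcDrive (φ t)
    have h2 := sum_balance (φ t)
    have h3 := sum_balance βs
    simp only [h.load t ht, Finset.sum_const_zero] at h2
    simp only [hs.omega, hs.load, hs.omega_eq_zero, Pi.zero_apply, mul_zero,
      Finset.sum_const_zero] at h3
    have h4 : ∑ i, βs.pM i = ∑ i, S.K i * S.kc i * βs.pc i :=
      Finset.sum_congr rfl fun i _ => by
        rw [pM_eq_of_xMRate_eq_zero (hs.xM i), Point.u, hs.omega_eq_zero, Pi.zero_apply]
        ring
    have h5 : ∑ i, S.K i * (φ t).u i = ∑ i, S.K i * S.kc i * (φ t).pc i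
        - ∑ i, S.K i * S.kd i * (φ t).omega (Sum.inl i) := by
      rw [← Finset.sum_sub_distrib]
      refine Finset.sum_congr rfl fun i _ => ?_
      rw [Point.u]
      ring
    simp only [mul_sub, sub_mul, Finset.sum_sub_distrib, one_mul]
    linarith
  have hWlim : Tendsto (fun t => ∑ i, S.γ i * ((φ t).pc i - βs.pc i)) atTop (𝓝 0) := by
    refine tendsto_zero_of_hasDerivWithinAt_neg_mul_add (a := κ / Γ) (div_pos hκ0 hΓ0)
      (g := fun t => κ / Γ * ∑ i, S.γ i * ((φ t).pc i - (φ t).pc j)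
        - ∑ i, S.K i * S.kc i * ((φ t).pc i - (φ t).pc j)
        + (∑ i, 1 * (φ t).genBalance i + ∑ i, S.Λ i * (φ t).omega i
          + ∑ i, (S.K i * S.kd i - S.kf i) * (φ t).omega (Sum.inl i))) (fun t ht => ?_) ?_
    · refine (HasDerivWithinAt.fun_sum fun i _ =>
        ((h.pc t ht i).sub_const (βs.pc i)).const_mul (S.γ i)).congr_deriv ?_
      simp only [mul_div_cancel₀ _ (S.γ_pos _).ne']
      rw [hdrive t ht, hKs, hW]
      have := hΓ0.ne'
      field_simp
      ring
    · have h1 := ((hd.const_mul (κ / Γ)).sub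
        (tendsto_sum_mul_zero (fun i => S.K i * S.kc i) fun i => hpc i j)).add
        (((tendsto_sum_mul_zero (fun _ => 1) hgen).add (tendsto_sum_mul_zero S.Λ hω)).add
          (tendsto_sum_mul_zero (fun i => S.K i * S.kd i - S.kf i) fun i => hω (Sum.inl i)))
      simpa using h1
  have h1 : Tendsto (fun t => Γ * ((φ t).pc j - βs.pc j)) atTop (𝓝 0) := by
    have := hWlim.sub hd
    simp only [hW, add_sub_cancel_right, sub_zero] at this
    exact this
  have h2 := (h1.div_const Γ).add_const (βs.pc j)
  simpa [mul_div_cancel_left₀ _ hΓ0.ne'] using h2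

/-- The deviation of the generation state is a Hurwitz linear system driven by the vanishing input
deviation. -/
theorem tendsto_xM (h : S.IsSolution φ) (hs : S.IsEquilibrium βs)
    (hω : ∀ i, Tendsto (fun t => (φ t).omega i) atTop (𝓝 0))
    (hpc : ∀ j, Tendsto (fun t => (φ t).pc j) atTop (𝓝 (βs.pc j))) (j : G) :
    Tendsto (fun t => (φ t).xM j) atTop (𝓝 (βs.xM j)) := by
  have hu : Tendsto (fun t => (φ t).u j - βs.u j) atTop (𝓝 0) := by
    have h1 := ((((hpc j).const_mul (S.kc j)).sub ((hω (Sum.inl j)).const_mul (S.kd j))).sub_const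
      (βs.u j))
    have h2 : S.kc j * βs.pc j - S.kd j * 0 - βs.u j = 0 := by
      rw [Point.u, hs.omega_eq_zero, Pi.zero_apply, sub_self]
    rwa [h2] at h1
  have hx : Tendsto (fun t => (φ t).xM j - βs.xM j) atTop (𝓝 0) := by
    refine (S.A_hurwitz j).tendsto_zero (g := fun t => ((φ t).u j - βs.u j) • S.B j)
      (fun t ht => ?_) (by simpa using hu.smul_const (S.B j))
    refine ((h.xM t ht j).sub_const _).congr_deriv ?_
    have h2 := hs.xM j
    rw [Point.xMRate] at h2 ⊢
    rw [Matrix.mulVec_sub, sub_smul, ← sub_zero (S.A j *ᵥ (φ t).xM j + (φ t).u j • S.B j), ← h2]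
    abel
  simpa using hx.add_const (βs.xM j)

end IsSolution

theorem continuous_toPoint : Continuous S.toPoint :=
  continuous_fst.prodMk ((continuous_pi fun i => (S.contDiff_omega i).continuous).prodMk
    (by fun_prop))

theorem isEquilibrium_of_eq (hs : S.IsEquilibrium βs) {β : S.Point} (hω : β.omega = 0)
    (hx : β.xM = βs.xM) (hp : β.pc = βs.pc) (hgen : ∀ j, β.genBalance j = 0)
    (hload : ∀ j, β.loadBalance j = 0) : S.IsEquilibrium β := by
  have hu : β.u = βs.u := by
    funext j
    rw [Point.u, Point.u, hω, hp, hs.omega_eq_zero]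
  have hpM : β.pM = βs.pM := by
    funext j
    rw [Point.pM, Point.pM, hx, hu]
  refine ⟨fun e => ?_, hgen, hload, fun j => ?_, fun j => ?_⟩
  · rw [Point.etaRate, hω, Pi.zero_apply, Pi.zero_apply, sub_zero]
  · rw [← hs.xM j, Point.xMRate, Point.xMRate, hx, hu]
  · rw [← hs.pc j, Point.pcDrive, Point.pcDrive, hpM, hu, hp, hω, hs.omega_eq_zero]

/-- If the distance stayed at least ε at arbitrarily late times, compactness would give a cluster
state at distance at least ε. All quantities with known limits take those values there, which makes
it an equilibrium whatever its angles: a contradiction. -/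
theorem IsSolution.convergesTo (hs : S.IsEquilibrium βs) {φ : ℝ → S.Point} (h : S.IsSolution φ)
    {s : Set S.State} (hc : IsCompact s) (hmem : ∀ t, 0 ≤ t → (φ t).state ∈ s)
    (hω : ∀ i, Tendsto (fun t => (φ t).omega i) atTop (𝓝 0))
    (hgen : ∀ j, Tendsto (fun t => (φ t).genBalance j) atTop (𝓝 0))
    (hpc : ∀ j, Tendsto (fun t => (φ t).pc j) atTop (𝓝 (βs.pc j)))
    (hx : ∀ j, Tendsto (fun t => (φ t).xM j) atTop (𝓝 (βs.xM j))) :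
    S.ConvergesTo φ {β | S.IsEquilibrium β} := by
  set T : Set S.Point := {β | S.IsEquilibrium β} with hT
  have hcont : Continuous fun σ : S.State => Metric.infEDist (S.toPoint σ) T :=
    Metric.continuous_infEDist.comp continuous_toPoint
  have key : Tendsto (fun t => Metric.infEDist (φ t) T) atTop (𝓝 0) := by
    rw [tendsto_order]
    refine ⟨fun a ha => absurd ha not_lt_zero, fun ε hε => ?_⟩
    by_contra hfreq
    have hclosed : IsCompact (s ∩ {σ | ε ≤ Metric.infEDist (S.toPoint σ) T}) :=
      hc.inter_right (isClosed_le continuous_const hcont)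
    have hf : ∃ᶠ t in atTop,
        (φ t).state ∈ s ∩ {σ | ε ≤ Metric.infEDist (S.toPoint σ) T} := by
      refine ((not_eventually.1 hfreq).and_eventually (eventually_ge_atTop 0)).mono
        fun t ht => ⟨hmem t ht.2, ?_⟩
      rw [mem_ofPred_eq, h.toPoint_state ht.2]
      exact not_lt.1 ht.1
    obtain ⟨σ, hσ, hclus⟩ := hclosed.exists_mapClusterPt_of_frequently hf
    have hlim : ∀ {X : Type _} [TopologicalSpace X] [T2Space X] {F : S.Point → X} {x : X},
        Continuous (fun σ => F (S.toPoint σ)) → Tendsto (fun t => F (φ t)) atTop (𝓝 x) →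
        F (S.toPoint σ) = x := by
      intro X _ _ F x hF hx
      have h1 : MapClusterPt (F (S.toPoint σ)) atTop fun t => F (S.toPoint (φ t).state) :=
        MapClusterPt.continuousAt_comp (f := fun σ => F (S.toPoint σ)) hF.continuousAt hclus
      have h2 : Tendsto (fun t => F (S.toPoint (φ t).state)) atTop (𝓝 x) := by
        refine hx.congr' ?_
        filter_upwards [eventually_ge_atTop 0] with t ht
        rw [h.toPoint_state ht]
      exact eq_of_nhds_neBot (h1.clusterPt.neBot.mono (inf_le_inf_left _ h2))
    have heq : S.IsEquilibrium (S.toPoint σ) := by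
      refine isEquilibrium_of_eq hs (funext fun i => ?_) (funext fun j => ?_)
        (funext fun j => ?_) (fun j => ?_) (S.loadBalance_toPoint σ)
      · exact hlim (F := fun β => β.omega i) (S.contDiff_omega i).continuous (hω i)
      · exact hlim (F := fun β => β.xM j)
          (continuous_pi fun k => (S.contDiff_xM j k).continuous) (hx j)
      · exact hlim (F := fun β => β.pc j) (S.contDiff_pc j).continuous (hpc j)
      · exact hlim (F := fun β => β.genBalance j) (S.contDiff_genBalance j).continuous (hgen j)
    have h0 : Metric.infEDist (S.toPoint σ) T = 0 := Metric.infEDist_zero_of_mem heq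
    have h1 := hσ.2
    rw [mem_ofPred_eq, h0] at h1
    exact absurd h1 (not_le.2 hε)
  exact key

end PowerSystem

theorem theorem1 {G L : Type*} [Fintype G] [Fintype L] (S : PowerSystem G L)
    (q : G → ℝ) (hq : ∀ j, 0 < q j)
    (βs : S.Point) (heq : S.IsEquilibrium βs)
    (hangle : ∀ e, |βs.eta e| < Real.pi / 2)
    (hdesign : S.DesignCondition)
    (hopt : ∀ j, S.kc j = 1 / (q j * S.K j)) :
    ∃ U : Set S.State, IsOpen U ∧ βs.state ∈ U ∧
      (∀ s ∈ U, ∃ φ : ℝ → S.Point, S.IsSolution φ ∧ (φ 0).state = s) ∧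
      ∀ φ : ℝ → S.Point, S.IsSolution φ → (φ 0).state ∈ U →
        S.ConvergesTo φ
          {β | S.IsEquilibrium β ∧ β.omega = 0 ∧ S.IsOGRSolution q β.pM} := by
  have hK : ∀ j, S.K j * S.kc j = 1 / q j := by
    intro j
    have h1 := S.kc_pos j
    -- Division by zero yields 0 here, so positivity of `kc j` excludes `K j = 0`.
    have h2 : S.K j ≠ 0 := by
      intro h0
      rw [hopt, h0, mul_zero, div_zero] at h1
      exact lt_irrefl _ h1
    rw [hopt]
    have := (hq j).ne'
    field_simp
  have hK0 : ∀ j, 0 < S.K j * S.kc j := fun j => by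
    rw [hK]
    exact one_div_pos.2 (hq j)
  choose P Λh hP hΛ hD using hdesign
  obtain ⟨s, U, hc, hsangle, hU, hmemU, htrap⟩ :=
    PowerSystem.exists_trapping_neighborhood heq hangle hP hΛ hD
  refine ⟨U, hU, hmemU, fun σ _ => S.exists_isSolution σ, fun φ hφ h0 => ?_⟩
  have hmem := htrap φ hφ h0
  obtain ⟨hω, hpc⟩ := hφ.tendsto_omega_and_pc_sub heq hP hΛ hD
    (hφ.tendsto_energyRate hc hmem hsangle heq hangle hP hΛ hD)
  have hgen := hφ.tendsto_genBalance hc hmem hω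
  have hpc' := hφ.tendsto_pc heq hK0 hω hpc hgen
  have hset : {β | S.IsEquilibrium β ∧ β.omega = 0 ∧ S.IsOGRSolution q β.pM}
      = {β | S.IsEquilibrium β} :=
    Set.ext fun β => ⟨fun h => h.1, fun h => ⟨h, h.omega_eq_zero, h.isOGRSolution hq hK⟩⟩
  rw [hset]
  exact hφ.convergesTo heq hc hmem hω hgen hpc' (hφ.tendsto_xM heq hω hpc')
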